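/- Let $d\in\mathbb N$ and let $\Omega\subset\mathbb R^d$ be open. **Colombeau algebra.** For $f\in C^\infty(\Omega)$ (complex valued), $K\subset\Omega$ compact and $l\in\mathbb N$ put $p_{K,l}(f)=\sup_{x\in K,\,|\alpha|\le l}|\partial^\alpha f(x)|$. Let $\mathcal F(C^\infty(\Omega))$ be the algebra of nets $(f_\varepsilon)_\varepsilon\in C^\infty(\Omega)^{(0,1]}$ such that for all $l$ and all compact $K\subset\Omega$ there is $q\in\mathbb N$ with $p_{K,l}(f_\varepsilon)=o(\varepsilon^{-q})$ as $\varepsilon\to0$, and let $\mathcal N(C^\infty(\Omega))$ be its ideal of nets such that $p_{K,l}(f_\varepsilon)=o(\varepsilon^{p})$ for all $l$, all compact $K\subset\Omega$ and all $p\in\mathbb N$. Let $\mathcal G(\Omega)=\mathcal F(C^\infty(\Omega))/\mathcal N(C^\infty(\Omega))$, write $[(f_\varepsilon)_\varepsilon]$ for the class of a net, and let $\sigma:C^\infty(\Omega)\to\mathcal G(\Omega)$, $\sigma(f)=[(f)_\varepsilon]$ (constant net). **Mollifiers.** Let $\rho\in\mathcal S(\mathbb R^d)$ be even with $\int\rho(x)\,dx=1$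 and $\int x^m\rho(x)\,dx=0$ for all $m\in\mathbb N^d\setminus\{0\}$. Let $\chi\in\mathcal D(\mathbb R^d)$ with $0\le\chi\le1$, $\chi(x)=1$ for $|x|\le1$ and $\chi(x)=0$ for $|x|\ge2$. Put $\theta_\varepsilon(x)=\varepsilon^{-d}\rho(x/\varepsilon)\,\chi(x|\ln\varepsilon|)$ for $0<\varepsilon<1$, and $\theta_1=1$. **Cutoffs.** For $\varepsilon\in(0,1]$ let $K_\varepsilon=\{x\in\Omega : d(x,\mathbb R^d\setminus\Omega)\ge\varepsilon,\ |x|\le1/\varepsilon\}$ (with $d(x,\emptyset)=+\infty$), and let $\kappa_\varepsilon\in\mathcal D(\Omega)$ with $0\le\kappa_\varepsilon\le1$ and $\kappa_\varepsilon=1$ on $K_\varepsilon$. For $T\in\mathcal D'(\Omega)$ and $y\in\Omega$ let $((\kappa_\varepsilon T)*\theta_\varepsilon)(y)=\langle T,\ x\mapsto\kappa_\varepsilon(x)\,\theta_\varepsilon(y-x)\rangle$. **Proposition.** For every $T\in\mathcal D'(\Omega)$ the net $((\kappa_\varepsilon T)*\theta_\varepsilon)_\varepsilon$ belongs to $\mathcal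 F(C^\infty(\Omega))$, and the map $$\iota_S:\mathcal D'(\Omega)\to\mathcal G(\Omega),\qquad T\mapsto\big[((\kappa_\varepsilon T)*\theta_\varepsilon)_\varepsilon\big]$$ is $\mathbb C$-linear and injective. Moreover $\iota_S(f)=\sigma(f)$ for every $f\in C^\infty(\Omega)$, where $f$ is identified with the distribution $\varphi\mapsto\int_\Omega f\varphi\,dx$. -/

import Mathlib

open scoped Distributions ContDiff SchwartzMap

noncomputable section

namespace Colombeau

open TopologicalSpace MeasureTheory Asymptotics Filter Topology

variable {d : ℕ}

/-! ### Smooth functions on an open set -/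

/-- Extension by zero of a function on `Ω` to the whole space (only used to differentiate and to
integrate inside `Ω`). -/
def zeroExt (Ω : Opens (EuclideanSpace ℝ (Fin d))) (f : Ω → ℂ) : EuclideanSpace ℝ (Fin d) → ℂ :=
  Function.extend (Subtype.val : Ω → EuclideanSpace ℝ (Fin d)) f 0

theorem zeroExt_apply {Ω : Opens (EuclideanSpace ℝ (Fin d))} (f : Ω → ℂ) (x : Ω) :
    zeroExt Ω f x = f x :=
  Subtype.val_injective.extend_apply f 0 x

theorem zeroExt_add {Ω : Opens (EuclideanSpace ℝ (Fin d))} (f g : Ω → ℂ) :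
    zeroExt Ω (f + g) = zeroExt Ω f + zeroExt Ω g := by
  simpa [zeroExt] using
    Function.extend_add (Subtype.val : Ω → EuclideanSpace ℝ (Fin d)) f g (0 : EuclideanSpace ℝ (Fin d) → ℂ) 0

theorem zeroExt_mul {Ω : Opens (EuclideanSpace ℝ (Fin d))} (f g : Ω → ℂ) :
    zeroExt Ω (f * g) = zeroExt Ω f * zeroExt Ω g := by
  simpa [zeroExt] using
    Function.extend_mul (Subtype.val : Ω → EuclideanSpace ℝ (Fin d)) f g (0 : EuclideanSpace ℝ (Fin d) → ℂ) 0

/-- `C^∞(Ω)`: the algebra of complex valued smooth functions on the open set `Ω ⊆ ℝ^d`. -/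
def SmoothFn (Ω : Opens (EuclideanSpace ℝ (Fin d))) : Subalgebra ℂ (Ω → ℂ) where
  carrier := {f | ContDiffOn ℝ ∞ (zeroExt Ω f) Ω}
  add_mem' {f g} hf hg := by
    have h : ContDiffOn ℝ ∞ (zeroExt Ω f + zeroExt Ω g) Ω := ContDiffOn.add hf hg
    rwa [← zeroExt_add] at h
  mul_mem' {f g} hf hg := by
    have h : ContDiffOn ℝ ∞ (zeroExt Ω f * zeroExt Ω g) Ω := ContDiffOn.mul hf hg
    rwa [← zeroExt_mul] at h
  algebraMap_mem' c :=
    (contDiffOn_const (c := c)).congr fun x hx => zeroExt_apply _ (⟨x, hx⟩ : Ω)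

/-- `p_{K,l}(f)`: the supremum over `x ∈ K` of the derivatives of `f` of all orders `≤ l` at `x`.
The derivatives of order `i` are measured together, by the norm of the `i`-th Fréchet derivative. -/
def smoothSeminorm {Ω : Opens (EuclideanSpace ℝ (Fin d))} (K : Set (EuclideanSpace ℝ (Fin d)))
    (l : ℕ) (f : SmoothFn Ω) : ℝ :=
  sSup {r : ℝ | ∃ i ≤ l, ∃ x ∈ K, r = ‖iteratedFDeriv ℝ i (zeroExt Ω f) x‖}

section seminorm

variable {Ω : Opens (EuclideanSpace ℝ (Fin d))} {K : Set (EuclideanSpace ℝ (Fin d))} {l : ℕ}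

theorem iteratedFDeriv_zeroExt (f : Ω → ℂ) (i : ℕ) {x : EuclideanSpace ℝ (Fin d)} (hx : x ∈ Ω) :
    iteratedFDeriv ℝ i (zeroExt Ω f) x = iteratedFDerivWithin ℝ i (zeroExt Ω f) Ω x :=
  (iteratedFDerivWithin_of_isOpen i Ω.isOpen hx).symm

theorem le_smoothSeminorm (hK : IsCompact K) (hKΩ : K ⊆ Ω) (f : SmoothFn Ω) {i : ℕ} (hi : i ≤ l)
    {x : EuclideanSpace ℝ (Fin d)} (hx : x ∈ K) :
    ‖iteratedFDeriv ℝ i (zeroExt Ω f) x‖ ≤ smoothSeminorm K l f := by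
  refine le_csSup ?_ ⟨i, hi, x, hx, rfl⟩
  have h : ∀ j : ℕ, ∃ C, ∀ y ∈ K, ‖iteratedFDeriv ℝ j (zeroExt Ω f) y‖ ≤ C := by
    intro j
    refine hK.exists_bound_of_continuousOn ?_
    have h1 : ContinuousOn (iteratedFDerivWithin ℝ j (zeroExt Ω f) Ω) Ω :=
      ContDiffOn.continuousOn_iteratedFDerivWithin f.2 (mod_cast le_top) Ω.isOpen.uniqueDiffOn
    exact (h1.mono hKΩ).congr fun y hy => iteratedFDeriv_zeroExt _ _ (hKΩ hy)
  choose C hC using h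
  refine ⟨∑ j ∈ Finset.range (l + 1), |C j|, ?_⟩
  rintro r ⟨j, hj, y, hy, rfl⟩
  refine (hC j y hy).trans ((le_abs_self _).trans ?_)
  exact Finset.single_le_sum (f := fun j => |C j|) (fun _ _ => abs_nonneg _)
    (Finset.mem_range.2 (Nat.lt_succ_of_le hj))

theorem smoothSeminorm_le {f : SmoothFn Ω} {C : ℝ} (hC : 0 ≤ C)
    (h : ∀ i ≤ l, ∀ x ∈ K, ‖iteratedFDeriv ℝ i (zeroExt Ω f) x‖ ≤ C) :
    smoothSeminorm K l f ≤ C := by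
  refine Real.sSup_le ?_ hC
  rintro r ⟨i, hi, x, hx, rfl⟩
  exact h i hi x hx

theorem smoothSeminorm_nonneg (f : SmoothFn Ω) : 0 ≤ smoothSeminorm K l f := by
  refine Real.sSup_nonneg ?_
  rintro r ⟨i, hi, x, hx, rfl⟩
  exact norm_nonneg _

theorem smoothSeminorm_add_le (hK : IsCompact K) (hKΩ : K ⊆ Ω) (f g : SmoothFn Ω) :
    smoothSeminorm K l (f + g) ≤ smoothSeminorm K l f + smoothSeminorm K l g := by
  refine smoothSeminorm_le (add_nonneg (smoothSeminorm_nonneg _) (smoothSeminorm_nonneg _)) ?_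
  intro i hi x hx
  have h : iteratedFDeriv ℝ i (zeroExt Ω (f + g : SmoothFn Ω)) x =
      iteratedFDeriv ℝ i (zeroExt Ω f) x + iteratedFDeriv ℝ i (zeroExt Ω g) x := by
    rw [Subalgebra.coe_add, zeroExt_add, ← zeroExt_add, iteratedFDeriv_zeroExt _ _ (hKΩ hx),
      iteratedFDeriv_zeroExt _ _ (hKΩ hx), iteratedFDeriv_zeroExt _ _ (hKΩ hx), zeroExt_add]
    exact iteratedFDerivWithin_add_apply
      ((f.2 x (hKΩ hx)).of_le (mod_cast le_top)) ((g.2 x (hKΩ hx)).of_le (mod_cast le_top))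
      Ω.isOpen.uniqueDiffOn (hKΩ hx)
  rw [h]
  exact (norm_add_le _ _).trans
    (add_le_add (le_smoothSeminorm hK hKΩ f hi hx) (le_smoothSeminorm hK hKΩ g hi hx))

theorem smoothSeminorm_mul_le (hK : IsCompact K) (hKΩ : K ⊆ Ω) (f g : SmoothFn Ω) :
    smoothSeminorm K l (f * g) ≤ 2 ^ l * (smoothSeminorm K l f * smoothSeminorm K l g) := by
  have h0 := mul_nonneg (smoothSeminorm_nonneg (K := K) (l := l) f)
    (smoothSeminorm_nonneg (K := K) (l := l) g)
  refine smoothSeminorm_le (by positivity) ?_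
  intro i hi x hx
  rw [Subalgebra.coe_mul, iteratedFDeriv_zeroExt _ _ (hKΩ hx), zeroExt_mul]
  refine (norm_iteratedFDerivWithin_mul_le (n := i) (N := ∞) f.2 g.2 Ω.isOpen.uniqueDiffOn
    (hKΩ hx) (mod_cast le_top)).trans ?_
  have h1 : ∑ j ∈ Finset.range (i + 1), (i.choose j : ℝ) *
        ‖iteratedFDerivWithin ℝ j (zeroExt Ω f) Ω x‖ *
        ‖iteratedFDerivWithin ℝ (i - j) (zeroExt Ω g) Ω x‖ ≤
      ∑ j ∈ Finset.range (i + 1), (i.choose j : ℝ) *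
        (smoothSeminorm K l f * smoothSeminorm K l g) := by
    refine Finset.sum_le_sum fun j hj => ?_
    have hj' : j ≤ i := Nat.lt_succ_iff.1 (Finset.mem_range.1 hj)
    rw [mul_assoc, ← iteratedFDeriv_zeroExt _ _ (hKΩ hx), ← iteratedFDeriv_zeroExt _ _ (hKΩ hx)]
    exact mul_le_mul_of_nonneg_left
      (mul_le_mul (le_smoothSeminorm hK hKΩ f (hj'.trans hi) hx)
        (le_smoothSeminorm hK hKΩ g ((Nat.sub_le _ _).trans hi) hx) (norm_nonneg _)
        (smoothSeminorm_nonneg _)) (Nat.cast_nonneg _)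
  refine h1.trans ?_
  rw [← Finset.sum_mul]
  refine mul_le_mul_of_nonneg_right ?_ h0
  have h2 : ∑ j ∈ Finset.range (i + 1), (i.choose j : ℝ) = 2 ^ i := by
    exact_mod_cast Nat.sum_range_choose i
  rw [h2]
  exact pow_le_pow_right₀ (by norm_num) hi

end seminorm

/-! ### The Colombeau algebra -/

/-- The filter `ε → 0` on the index set `(0, 1]`. -/
def atZero : Filter (Set.Ioc (0 : ℝ) 1) :=
  comap Subtype.val (𝓝 0)

/-- `C^∞(Ω)^{(0,1]}`: nets `(f_ε)_{0 < ε ≤ 1}` of smooth functions on `Ω`. -/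
def Net (Ω : Opens (EuclideanSpace ℝ (Fin d))) : Type :=
  Set.Ioc (0 : ℝ) 1 → SmoothFn Ω

instance (Ω : Opens (EuclideanSpace ℝ (Fin d))) : CommRing (Net Ω) :=
  inferInstanceAs (CommRing (Set.Ioc (0 : ℝ) 1 → SmoothFn Ω))

instance (Ω : Opens (EuclideanSpace ℝ (Fin d))) : Algebra ℂ (Net Ω) :=
  inferInstanceAs (Algebra ℂ (Set.Ioc (0 : ℝ) 1 → SmoothFn Ω))

/-- Moderate nets: for all `l` and all compact `K ⊆ Ω`, `p_{K,l}(f_ε) = o(ε^{-q})` for some `q`. -/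
def IsModerate {Ω : Opens (EuclideanSpace ℝ (Fin d))} (f : Net Ω) : Prop :=
  ∀ (l : ℕ) (K : Set (EuclideanSpace ℝ (Fin d))), IsCompact K → K ⊆ Ω → ∃ q : ℕ,
    (fun ε => smoothSeminorm K l (f ε)) =o[atZero] fun ε => ((ε : ℝ) ^ q)⁻¹

/-- Negligible nets: for all `l`, all compact `K ⊆ Ω` and all `p`, `p_{K,l}(f_ε) = o(ε^p)`. -/
def IsNegligible {Ω : Opens (EuclideanSpace ℝ (Fin d))} (f : Net Ω) :
    Prop :=
  ∀ (l : ℕ) (K : Set (EuclideanSpace ℝ (Fin d))), IsCompact K → K ⊆ Ω → ∀ p : ℕ,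
    (fun ε => smoothSeminorm K l (f ε)) =o[atZero] fun ε => (ε : ℝ) ^ p

section closure

variable {Ω : Opens (EuclideanSpace ℝ (Fin d))}

theorem isBigO_inv_pow {q r : ℕ} (h : q ≤ r) :
    (fun ε : Set.Ioc (0 : ℝ) 1 => ((ε : ℝ) ^ q)⁻¹) =O[atZero] fun ε => ((ε : ℝ) ^ r)⁻¹ := by
  refine IsBigO.of_bound 1 (Eventually.of_forall fun ε => ?_)
  have h0 : (0 : ℝ) < ε := ε.2.1
  rw [one_mul, Real.norm_of_nonneg (by positivity), Real.norm_of_nonneg (by positivity)]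
  exact inv_anti₀ (by positivity) (pow_le_pow_of_le_one h0.le ε.2.2 h)

theorem isLittleO_const_inv (c : ℝ) :
    (fun _ : Set.Ioc (0 : ℝ) 1 => c) =o[atZero] fun ε => ((ε : ℝ) ^ 1)⁻¹ := by
  rw [isLittleO_const_left]
  right
  have h : Tendsto (Subtype.val : Set.Ioc (0 : ℝ) 1 → ℝ) atZero (𝓝[>] 0) := by
    rw [tendsto_nhdsWithin_iff]
    exact ⟨tendsto_comap, Eventually.of_forall fun ε => ε.2.1⟩
  have h2 := (tendsto_inv_nhdsGT_zero.comp h)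
  refine tendsto_norm_atTop_atTop.comp ?_
  simpa [Function.comp_def] using h2

theorem isModerate_const (f : SmoothFn Ω) : IsModerate (Ω := Ω) fun _ => f :=
  fun _ _ _ _ => ⟨1, isLittleO_const_inv _⟩

theorem IsModerate.add {f g : Net Ω} (hf : IsModerate f)
    (hg : IsModerate g) : IsModerate (f + g) := by
  intro l K hK hKΩ
  obtain ⟨q, hq⟩ := hf l K hK hKΩ
  obtain ⟨r, hr⟩ := hg l K hK hKΩ
  refine ⟨max q r, IsBigO.trans_isLittleO (IsBigO.of_bound 1 (Eventually.of_forall fun ε => ?_))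
    ((hq.trans_isBigO (isBigO_inv_pow (le_max_left q r))).add
      (hr.trans_isBigO (isBigO_inv_pow (le_max_right q r))))⟩
  rw [one_mul, Real.norm_of_nonneg (smoothSeminorm_nonneg _), Real.norm_of_nonneg
    (add_nonneg (smoothSeminorm_nonneg _) (smoothSeminorm_nonneg _))]
  exact smoothSeminorm_add_le hK hKΩ _ _

theorem norm_smoothSeminorm_mul_le {K : Set (EuclideanSpace ℝ (Fin d))} (hK : IsCompact K)
    (hKΩ : K ⊆ Ω) (l : ℕ) (f g : SmoothFn Ω) :
    ‖smoothSeminorm K l (f * g)‖ ≤ 2 ^ l * ‖smoothSeminorm K l f * smoothSeminorm K l g‖ := by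
  rw [Real.norm_of_nonneg (smoothSeminorm_nonneg _), Real.norm_of_nonneg
    (mul_nonneg (smoothSeminorm_nonneg _) (smoothSeminorm_nonneg _))]
  exact smoothSeminorm_mul_le hK hKΩ _ _

theorem IsModerate.mul {f g : Net Ω} (hf : IsModerate f)
    (hg : IsModerate g) : IsModerate (f * g) := by
  intro l K hK hKΩ
  obtain ⟨q, hq⟩ := hf l K hK hKΩ
  obtain ⟨r, hr⟩ := hg l K hK hKΩ
  have h : (fun ε : Set.Ioc (0 : ℝ) 1 => ((ε : ℝ) ^ (q + r))⁻¹) =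
      fun ε : Set.Ioc (0 : ℝ) 1 => ((ε : ℝ) ^ q)⁻¹ * ((ε : ℝ) ^ r)⁻¹ := by
    funext ε
    rw [pow_add, mul_inv]
  refine ⟨q + r, ?_⟩
  rw [h]
  exact IsBigO.trans_isLittleO (IsBigO.of_bound (2 ^ l) (Eventually.of_forall fun ε =>
    norm_smoothSeminorm_mul_le hK hKΩ l (f ε) (g ε))) (hq.mul hr)

theorem IsNegligible.add {f g : Net Ω} (hf : IsNegligible f)
    (hg : IsNegligible g) : IsNegligible (f + g) := by
  intro l K hK hKΩ p
  refine IsBigO.trans_isLittleO (IsBigO.of_bound 1 (Eventually.of_forall fun ε => ?_))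
    ((hf l K hK hKΩ p).add (hg l K hK hKΩ p))
  rw [one_mul, Real.norm_of_nonneg (smoothSeminorm_nonneg _), Real.norm_of_nonneg
    (add_nonneg (smoothSeminorm_nonneg _) (smoothSeminorm_nonneg _))]
  exact smoothSeminorm_add_le hK hKΩ _ _

theorem IsNegligible.zero : IsNegligible (0 : Net Ω) := by
  intro l K hK hKΩ p
  have h : ∀ ε : Set.Ioc (0 : ℝ) 1,
      smoothSeminorm K l ((0 : Net Ω) ε) = 0 := by
    intro ε
    refine le_antisymm (smoothSeminorm_le le_rfl fun i _ x _ => ?_) (smoothSeminorm_nonneg _)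
    have h0 : zeroExt Ω ((0 : SmoothFn Ω) : Ω → ℂ) = 0 := by
      simpa using zeroExt_add (Ω := Ω) 0 0
    change ‖iteratedFDeriv ℝ i (zeroExt Ω ((0 : SmoothFn Ω) : Ω → ℂ)) x‖ ≤ 0
    rw [h0]
    simp
  simp only [h]
  exact isLittleO_zero _ _

theorem IsModerate.mul_isNegligible {f g : Net Ω} (hf : IsModerate f)
    (hg : IsNegligible g) : IsNegligible (f * g) := by
  intro l K hK hKΩ p
  obtain ⟨q, hq⟩ := hf l K hK hKΩ
  have h : (fun ε : Set.Ioc (0 : ℝ) 1 => (ε : ℝ) ^ p) =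
      fun ε : Set.Ioc (0 : ℝ) 1 => ((ε : ℝ) ^ q)⁻¹ * (ε : ℝ) ^ (q + p) := by
    funext ε
    have h0 : (ε : ℝ) ≠ 0 := ε.2.1.ne'
    rw [pow_add]
    field_simp
  rw [h]
  exact IsBigO.trans_isLittleO (IsBigO.of_bound (2 ^ l) (Eventually.of_forall fun ε =>
    norm_smoothSeminorm_mul_le hK hKΩ l (f ε) (g ε))) (hq.mul (hg l K hK hKΩ (q + p)))

end closure

/-- `F(C^∞(Ω))`: the algebra of moderate nets. -/
def Moderate (Ω : Opens (EuclideanSpace ℝ (Fin d))) : Subalgebra ℂ (Net Ω) where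
  carrier := {f | IsModerate f}
  add_mem' hf hg := IsModerate.add hf hg
  mul_mem' hf hg := IsModerate.mul hf hg
  algebraMap_mem' c := isModerate_const (algebraMap ℂ (SmoothFn Ω) c)

/-- `N(C^∞(Ω))`: the negligible nets, an ideal of the algebra of moderate nets. -/
def Negligible (Ω : Opens (EuclideanSpace ℝ (Fin d))) : Ideal (Moderate Ω) where
  carrier := {f | IsNegligible (f : Net Ω)}
  add_mem' hf hg := IsNegligible.add hf hg
  zero_mem' := IsNegligible.zero
  smul_mem' f _ hg := IsModerate.mul_isNegligible f.2 hg

/-- `G(Ω) = F(C^∞(Ω)) / N(C^∞(Ω))`: the simplified Colombeau algebra on `Ω`. -/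
abbrev G (Ω : Opens (EuclideanSpace ℝ (Fin d))) : Type :=
  Moderate Ω ⧸ Negligible Ω

/-- The class `[(f_ε)_ε]` in `G(Ω)` of a moderate net. -/
def cls {Ω : Opens (EuclideanSpace ℝ (Fin d))} (f : Moderate Ω) : G Ω :=
  Ideal.Quotient.mk (Negligible Ω) f

/-- The canonical map `σ : C^∞(Ω) → G(Ω)`, sending `f` to the class of the constant net `f`. -/
def sigma {Ω : Opens (EuclideanSpace ℝ (Fin d))} (f : SmoothFn Ω) : G Ω :=
  cls ⟨fun _ => f, isModerate_const f⟩

/-! ### Distributions -/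

/-- `D'(Ω)`: the continuous `ℂ`-linear forms on the space `D(Ω)` of complex valued test functions
(with its canonical LF topology). -/
abbrev Distr (Ω : Opens (EuclideanSpace ℝ (Fin d))) : Type :=
  𝓓(Ω, ℂ) →L[ℂ] ℂ

theorem locallyIntegrableOn_zeroExt {Ω : Opens (EuclideanSpace ℝ (Fin d))} (f : SmoothFn Ω) :
    LocallyIntegrableOn (zeroExt Ω f) Ω :=
  (ContDiffOn.continuousOn f.2).locallyIntegrableOn Ω.isOpen.measurableSet

/-- The regular distribution `φ ↦ ∫_Ω φ f` attached to a smooth function `f` on `Ω`. -/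
def ofSmooth {Ω : Opens (EuclideanSpace ℝ (Fin d))} (f : SmoothFn Ω) : Distr Ω :=
  TestFunction.integralAgainstBilinCLM (ContinuousLinearMap.mul ℂ ℂ) volume (zeroExt Ω f)

theorem ofSmooth_apply {Ω : Opens (EuclideanSpace ℝ (Fin d))} (f : SmoothFn Ω) (φ : 𝓓(Ω, ℂ)) :
    ofSmooth f φ = ∫ x, φ x * zeroExt Ω f x :=
  TestFunction.integralAgainstBilinCLM_eq_integral (locallyIntegrableOn_zeroExt f)

/-- The test function `κ ψ` on `Ω`, for a cutoff `κ ∈ D(Ω)` and a smooth function `ψ` on `ℝ^d`. -/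
def cutMul {Ω : Opens (EuclideanSpace ℝ (Fin d))} (κ : 𝓓(Ω, ℝ)) (ψ : EuclideanSpace ℝ (Fin d) → ℂ)
    (hψ : ContDiff ℝ ∞ ψ) : 𝓓(Ω, ℂ) where
  toFun x := κ x • ψ x
  contDiff' := κ.contDiff.smul hψ
  hasCompactSupport' := κ.hasCompactSupport.smul_right
  tsupport_subset' := (tsupport_smul_subset_left κ ψ).trans κ.tsupport_subset

/-- The convolution `(κT) ∗ θ` of the compactly supported distribution `κT` (which acts on smooth
functions by `⟨κT, ψ⟩ = ⟨T, κψ⟩`) with the smooth function `θ`, that is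
`((κT) ∗ θ)(y) = ⟨κT, x ↦ θ(y - x)⟩`. -/
def cutConv {Ω : Opens (EuclideanSpace ℝ (Fin d))} (κ : 𝓓(Ω, ℝ)) (T : Distr Ω)
    (θ : EuclideanSpace ℝ (Fin d) → ℂ) (hθ : ContDiff ℝ ∞ θ) (y : EuclideanSpace ℝ (Fin d)) : ℂ :=
  T (cutMul κ (fun x => θ (y - x)) (hθ.comp (contDiff_const.sub contDiff_id)))

/-! ### Mollifiers and cutoffs -/

/-- `θ_ε(x) = ε^{-d} ρ(x/ε) χ(x |ln ε|)` for `0 < ε < 1`, and `θ_1 = 1`. -/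
def theta (ρ : 𝓢(EuclideanSpace ℝ (Fin d), ℂ))
    (χ : 𝓓((⊤ : Opens (EuclideanSpace ℝ (Fin d))), ℝ)) (ε : Set.Ioc (0 : ℝ) 1)
    (x : EuclideanSpace ℝ (Fin d)) : ℂ :=
  if (ε : ℝ) = 1 then 1
  else ((((ε : ℝ) ^ d)⁻¹ : ℝ) : ℂ) * ρ ((ε : ℝ)⁻¹ • x) * ((χ (|Real.log ε| • x) : ℝ) : ℂ)

theorem contDiff_theta (ρ : 𝓢(EuclideanSpace ℝ (Fin d), ℂ))
    (χ : 𝓓((⊤ : Opens (EuclideanSpace ℝ (Fin d))), ℝ)) (ε : Set.Ioc (0 : ℝ) 1) :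
    ContDiff ℝ ∞ (theta ρ χ ε) := by
  unfold theta
  by_cases h : (ε : ℝ) = 1
  · simp only [h, if_true]
    exact contDiff_const
  · simp only [h, if_false]
    refine (contDiff_const.mul ((ρ.smooth ⊤).comp (contDiff_const_smul _))).mul ?_
    exact Complex.ofRealCLM.contDiff.comp (χ.contDiff.comp (contDiff_const_smul _))

/-- `K_ε = {x ∈ Ω : d(x, ℝ^d ∖ Ω) ≥ ε, |x| ≤ 1/ε}`, the distance to the empty set being `+∞`. -/
def exhaustion (Ω : Opens (EuclideanSpace ℝ (Fin d))) (ε : ℝ) : Set (EuclideanSpace ℝ (Fin d)) :=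
  {x | x ∈ Ω ∧ ENNReal.ofReal ε ≤ Metric.infEDist x (Ω : Set (EuclideanSpace ℝ (Fin d)))ᶜ ∧
    ‖x‖ ≤ 1 / ε}

end Colombeau

end

/-!
Representing the compactly supported distribution `κ_ε T` by finitely many continuous functionals
applied to derivatives turns `(κ_ε T) ∗ θ_ε` into a finite sum `∑ i, Λ i (τ_y D^i θ̌_ε)`, where
`τ_y` is the translation by `y`. Since `y ↦ τ_y ψ` is a smooth map into the bounded continuous
functions for every test function `ψ`, such convolutions are smooth in `y`, are bounded by
derivatives of `θ_ε`, and may be integrated against test functions under the functionals.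

The supports of the `θ_ε` shrink to the origin, so near a compact set one fixed cutoff `η` replaces
all `κ_ε` with `ε` small. As all higher moments of `ρ` vanish, Taylor's formula shows that
`θ_ε ∗ u - u` is smaller than every power of `ε` for each test function `u`, together with all its
derivatives; the cutoff `χ (x |log ε|)` only costs powers of `|log ε|`. Applied to `u = η f` this
yields `ι_S(f) = σ(f)`. Applied to reflected test functions it yields weak convergence of
`(κ_ε T) ∗ θ_ε` to `T`, which forces `T = 0` when the net is negligible.
-/

namespace Colombeau

open TopologicalSpace MeasureTheory Asymptotics Filter Topology
open scoped BoundedContinuousFunction Convolution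

universe u

section Calculus

variable {E F : Type*} [NormedAddCommGroup E] [NormedSpace ℝ E] [NormedAddCommGroup F]
  [NormedSpace ℝ F]

theorem norm_iteratedFDeriv_iteratedFDeriv (k n : ℕ) (f : E → F) (x : E) :
    ‖iteratedFDeriv ℝ k (iteratedFDeriv ℝ n f) x‖ = ‖iteratedFDeriv ℝ (n + k) f x‖ := by
  induction n generalizing k with
  | zero =>
    rw [iteratedFDeriv_zero_eq_comp, LinearIsometryEquiv.norm_iteratedFDeriv_comp_left, zero_add]
  | succ n ih =>
    have h := LinearIsometryEquiv.norm_iteratedFDeriv_comp_left (𝕜 := ℝ) (G := E [×(n + 1)]→L[ℝ] F)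
      (continuousMultilinearCurryLeftEquiv ℝ (fun _ : Fin (n + 1) => E) F).symm
      (fderiv ℝ (iteratedFDeriv ℝ n f)) x k
    rw [iteratedFDeriv_succ_eq_comp_left, h, norm_iteratedFDeriv_fderiv, ih, add_right_comm,
      add_assoc]

theorem contDiff_iteratedFDeriv {f : E → F} (hf : ContDiff ℝ ∞ f) (n : ℕ) :
    ContDiff ℝ ∞ (iteratedFDeriv ℝ n f) :=
  hf.iteratedFDeriv_right (by exact_mod_cast le_top)

theorem contDiff_iteratedFDeriv_apply {f : E → F} (hf : ContDiff ℝ ∞ f) {n : ℕ} (m : Fin n → E) :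
    ContDiff ℝ ∞ fun x => iteratedFDeriv ℝ n f x m :=
  (ContinuousMultilinearMap.apply ℝ (fun _ : Fin n => E) F m).contDiff.comp
    (contDiff_iteratedFDeriv hf n)

theorem norm_iteratedFDeriv_iteratedFDeriv_apply_le {f : E → F} (hf : ContDiff ℝ ∞ f) (k : ℕ)
    {n : ℕ} (m : Fin n → E) (x : E) :
    ‖iteratedFDeriv ℝ k (fun y => iteratedFDeriv ℝ n f y m) x‖ ≤
      ‖iteratedFDeriv ℝ (n + k) f x‖ * ∏ i, ‖m i‖ := by
  let ev := ContinuousMultilinearMap.apply ℝ (fun _ : Fin n => E) F m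
  have hev : ‖ev‖ ≤ ∏ i, ‖m i‖ :=
    ev.opNorm_le_bound (by positivity) fun c => by
      rw [mul_comm]
      exact c.le_opNorm m
  rw [← norm_iteratedFDeriv_iteratedFDeriv, mul_comm]
  exact (ev.norm_iteratedFDeriv_comp_left (contDiff_iteratedFDeriv hf n).contDiffAt
    (mod_cast le_top)).trans (mul_le_mul_of_nonneg_right hev (norm_nonneg _))

theorem iteratedFDeriv_succ_apply_eq_fderiv_apply {f : E → F} (hf : ContDiff ℝ ∞ f) {n : ℕ}
    (m : Fin (n + 1) → E) (x : E) :
    iteratedFDeriv ℝ (n + 1) f x m =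
      iteratedFDeriv ℝ n (fun y => fderiv ℝ f y (m (Fin.last n))) x (Fin.init m) := by
  rw [iteratedFDeriv_succ_apply_right,
    iteratedFDeriv_clm_apply_const_apply (hf.fderiv_right (m := ∞) (by simp)) (mod_cast le_top)]

theorem norm_iteratedFDeriv_comp_neg (i : ℕ) (f : E → F) (x : E) :
    ‖iteratedFDeriv ℝ i (fun y => f (-y)) x‖ = ‖iteratedFDeriv ℝ i f (-x)‖ :=
  LinearIsometryEquiv.norm_iteratedFDeriv_comp_right (LinearIsometryEquiv.neg ℝ) f x i

theorem norm_iteratedFDeriv_smul_le_of_forall_le {f : E → ℝ} {g : E → F} {n : WithTop ℕ∞}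
    (hf : ContDiff ℝ n f) (hg : ContDiff ℝ n g) {i : ℕ} (hi : i ≤ n) {x : E} {A B : ℝ}
    (hA : ∀ j ≤ i, ‖iteratedFDeriv ℝ j f x‖ ≤ A) (hB : ∀ j ≤ i, ‖iteratedFDeriv ℝ j g x‖ ≤ B) :
    ‖iteratedFDeriv ℝ i (fun y => f y • g y) x‖ ≤ 2 ^ i * (A * B) := by
  have hA0 : 0 ≤ A := (norm_nonneg _).trans (hA 0 (Nat.zero_le i))
  calc ‖iteratedFDeriv ℝ i (fun y => f y • g y) x‖
      ≤ ∑ j ∈ Finset.range (i + 1), (i.choose j : ℝ) * ‖iteratedFDeriv ℝ j f x‖ *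
          ‖iteratedFDeriv ℝ (i - j) g x‖ :=
        norm_iteratedFDeriv_smul_le hf hg x hi
    _ ≤ ∑ j ∈ Finset.range (i + 1), (i.choose j : ℝ) * (A * B) := by
        refine Finset.sum_le_sum fun j hj => ?_
        rw [mul_assoc]
        gcongr
        exacts [hA j (Finset.mem_range_succ_iff.1 hj), hB _ (Nat.sub_le i j)]
    _ = 2 ^ i * (A * B) := by
        rw [← Finset.sum_mul]
        exact_mod_cast congrArg (fun n : ℕ => (n : ℝ) * (A * B)) (Nat.sum_range_choose i)

theorem norm_sub_sub_fderiv_le {f : E → F} (hf : ContDiff ℝ 2 f) {C : ℝ}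
    (hC : ∀ x, ‖iteratedFDeriv ℝ 2 f x‖ ≤ C) (x v : E) :
    ‖f (x + v) - f x - fderiv ℝ f x v‖ ≤ C * ‖v‖ ^ 2 := by
  have hC0 : 0 ≤ C := (norm_nonneg _).trans (hC 0)
  have hlip (y : E) : ‖fderiv ℝ f y - fderiv ℝ f x‖ ≤ C * ‖y - x‖ :=
    convex_univ.norm_image_sub_le_of_norm_fderiv_le (𝕜 := ℝ)
      (fun z _ => (hf.fderiv_right (m := 1) one_add_one_eq_two.le).differentiable one_ne_zero z)
      (fun z _ => by
        rw [← norm_iteratedFDeriv_one, norm_iteratedFDeriv_fderiv]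
        exact hC z) (Set.mem_univ _) (Set.mem_univ _)
  have h := (convex_segment x (x + v)).norm_image_sub_le_of_norm_hasFDerivWithin_le' (𝕜 := ℝ)
    (C := C * ‖v‖) (φ := fderiv ℝ f x)
    (fun y _ => (hf.differentiable two_ne_zero y).hasFDerivAt.hasFDerivWithinAt)
    (fun y hy => (hlip y).trans (mul_le_mul_of_nonneg_left
      (by simpa using norm_sub_le_of_mem_segment hy) hC0))
    (left_mem_segment ℝ _ _) (right_mem_segment ℝ _ _)
  simpa [sq, mul_assoc] using h

theorem norm_iteratedFDeriv_comp_smul_le {f : E → F} {N : ℕ} (hf : ContDiff ℝ N f) {C : ℝ}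
    (hC : ∀ i ≤ N, ∀ x, ‖iteratedFDeriv ℝ i f x‖ ≤ C) {a b : ℝ} (hab : |a| ≤ b) (hb : 1 ≤ b)
    {i : ℕ} (hi : i ≤ N) (x : E) :
    ‖iteratedFDeriv ℝ i (fun y => f (a • y)) x‖ ≤ b ^ N * C := by
  rw [iteratedFDeriv_comp_const_smul a (hf.of_le (mod_cast hi)), norm_smul, norm_pow,
    Real.norm_eq_abs]
  exact mul_le_mul ((pow_le_pow_left₀ (abs_nonneg a) hab i).trans (pow_le_pow_right₀ hb hi))
    (hC i hi _) (norm_nonneg _) (by positivity)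

theorem exists_norm_iteratedFDeriv_testFunction_le {U : Opens E} (f : 𝓓(U, F)) (N : ℕ) :
    ∃ C, ∀ i ≤ N, ∀ x, ‖iteratedFDeriv ℝ i f x‖ ≤ C := by
  have h (i : ℕ) : ∃ C, ∀ x, ‖iteratedFDeriv ℝ i f x‖ ≤ C :=
    (f.hasCompactSupport.iteratedFDeriv (𝕜 := ℝ) i).exists_bound_of_continuous
      (f.contDiff.continuous_iteratedFDeriv (mod_cast le_top))
  choose B hB using h
  obtain ⟨C, hC⟩ := ((Finset.range (N + 1)).image B).exists_le
  exact ⟨C, fun i hi x => (hB i x).trans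
    (hC _ (Finset.mem_image_of_mem B (Finset.mem_range_succ_iff.2 hi)))⟩

theorem exists_norm_iteratedFDeriv_schwartz_le (f : 𝓢(E, F)) (N : ℕ) :
    ∃ C, ∀ i ≤ N, ∀ x, ‖iteratedFDeriv ℝ i f x‖ ≤ C := by
  refine ⟨((Finset.Iic (0, N)).sup fun m => SchwartzMap.seminorm ℝ m.1 m.2) f, fun i hi x => ?_⟩
  simpa only [pow_zero, one_mul] using
    SchwartzMap.one_add_le_sup_seminorm_apply (𝕜 := ℝ) (m := (0, N)) le_rfl hi f x

end Calculus

section Convolution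

variable {E F F' F'' : Type*} [NormedAddCommGroup E] [NormedSpace ℝ E] [MeasurableSpace E]
  [BorelSpace E] [NormedAddCommGroup F] [NormedSpace ℝ F] [NormedAddCommGroup F']
  [NormedSpace ℝ F'] [NormedAddCommGroup F''] [NormedSpace ℝ F''] {μ : Measure E}
  [SFinite μ] [μ.IsAddLeftInvariant] {f : E → F} {g : E → F'}

theorem iteratedFDeriv_convolution_right_apply (L : F →L[ℝ] F' →L[ℝ] F'')
    (hf : LocallyIntegrable f μ) (hg : ContDiff ℝ ∞ g) (hgs : HasCompactSupport g) {n : ℕ}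
    (m : Fin n → E) (x : E) :
    iteratedFDeriv ℝ n (f ⋆[L, μ] g) x m = (f ⋆[L, μ] fun y => iteratedFDeriv ℝ n g y m) x := by
  induction n generalizing g with
  | zero => simp only [iteratedFDeriv_zero_apply]
  | succ n ih =>
    let v := m (Fin.last n)
    have hg' : ContDiff ℝ ∞ (fderiv ℝ g) := hg.fderiv_right (by simp)
    have hfderiv : (fun y => fderiv ℝ (f ⋆[L, μ] g) y v) = f ⋆[L, μ] fun y => fderiv ℝ g y v := by
      funext y
      rw [(hgs.hasFDerivAt_convolution_right L hf (hg.of_le (by simp)) y).fderiv,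
        convolution_precompR_apply L hf (hgs.fderiv ℝ) hg'.continuous]
    rw [iteratedFDeriv_succ_apply_eq_fderiv_apply
        (hgs.contDiff_convolution_right L hf (n := ⊤) hg), hfderiv,
      ih (hg'.clm_apply contDiff_const) (hgs.fderiv_apply ℝ v)]
    simp only [iteratedFDeriv_succ_apply_eq_fderiv_apply hg, v]

end Convolution

section Translation

variable {E F H : Type u} [NormedAddCommGroup E] [NormedSpace ℝ E] [NormedAddCommGroup F]
  [NormedSpace ℝ F] [NormedAddCommGroup H] [NormedSpace ℝ H]

/-- The translate `x ↦ f (x - y)` of a test function. As a function of `y` with values in the Banach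
space of bounded continuous functions it is smooth, so that continuous functionals can be applied to
its derivatives and its integrals. -/
def translate (f : 𝓓((⊤ : Opens E), F)) (y : E) : E →ᵇ F :=
  (f : E →ᵇ F).compContinuous ⟨fun x => x - y, by fun_prop⟩

/-- The map sending a bounded family `g` with values in `H`, read through `A` as a family of linear
maps, to the linear map `v ↦ (x ↦ A (g x) v)` into bounded families. It expresses the derivative of
`translate`; keeping `H` and `A` general allows for iteration. -/
noncomputable def familyFlip (A : H →L[ℝ] E →L[ℝ] F) : (E →ᵇ H) →L[ℝ] E →L[ℝ] (E →ᵇ F) :=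
  LinearMap.mkContinuous₂
    (LinearMap.mk₂ ℝ (fun g v => (A.flip v).compLeftContinuousBounded E g)
      (fun g h v => BoundedContinuousFunction.ext fun x => map_add (A.flip v) (g x) (h x))
      (fun c g v => BoundedContinuousFunction.ext fun x => map_smul (A.flip v) c (g x))
      (fun g v w => BoundedContinuousFunction.ext fun x => map_add (A (g x)) v w)
      (fun c g v => BoundedContinuousFunction.ext fun x => map_smul (A (g x)) c v))
    ‖A‖ fun g v => (BoundedContinuousFunction.norm_le (by positivity)).2 fun x =>
      (A.le_opNorm₂ (g x) v).trans (by gcongr; exact g.norm_coe_le_norm x)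

theorem norm_familyFlip_le (A : H →L[ℝ] E →L[ℝ] F) : ‖familyFlip A‖ ≤ ‖A‖ :=
  LinearMap.mkContinuous₂_norm_le _ (norm_nonneg A) _

theorem hasFDerivAt_translate {f : 𝓓((⊤ : Opens E), F)} {f' : 𝓓((⊤ : Opens E), H)}
    (A : H →L[ℝ] E →L[ℝ] F) (hf : ∀ x, fderiv ℝ f x = A (f' x)) (y : E) :
    HasFDerivAt (translate f) (-familyFlip A (translate f' y)) y := by
  obtain ⟨C, hC⟩ := exists_norm_iteratedFDeriv_testFunction_le f 2
  have hC0 : 0 ≤ C := (norm_nonneg _).trans (hC 2 le_rfl 0)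
  rw [hasFDerivAt_iff_isLittleO_nhds_zero]
  refine IsBigO.trans_isLittleO (.of_bound C (.of_forall fun v => ?_))
    (isLittleO_norm_pow_id one_lt_two)
  rw [norm_pow, norm_norm]
  refine (BoundedContinuousFunction.norm_le (by positivity)).2 fun x => ?_
  have h := norm_sub_sub_fderiv_le (contDiff_infty.1 f.contDiff 2) (hC 2 le_rfl) (x - y) (-v)
  rw [hf, norm_neg, map_neg, ← sub_eq_add_neg, sub_sub x y v] at h
  exact h

theorem fderiv_translate {f : 𝓓((⊤ : Opens E), F)} {f' : 𝓓((⊤ : Opens E), H)}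
    (A : H →L[ℝ] E →L[ℝ] F) (hf : ∀ x, fderiv ℝ f x = A (f' x)) :
    fderiv ℝ (translate f) = fun y => -familyFlip A (translate f' y) :=
  funext fun y => (hasFDerivAt_translate A hf y).fderiv

theorem contDiff_translate_succ {f : 𝓓((⊤ : Opens E), F)} {f' : 𝓓((⊤ : Opens E), H)}
    (A : H →L[ℝ] E →L[ℝ] F) (hf : ∀ x, fderiv ℝ f x = A (f' x)) {n : ℕ}
    (h : ContDiff ℝ n (translate f')) : ContDiff ℝ (n + 1) (translate f) := by
  rw [contDiff_succ_iff_fderiv, fderiv_translate A hf]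
  exact ⟨fun y => (hasFDerivAt_translate A hf y).differentiableAt, by simp,
    ((familyFlip A).contDiff.comp h).neg⟩

theorem norm_iteratedFDeriv_succ_translate_le {f : 𝓓((⊤ : Opens E), F)} {f' : 𝓓((⊤ : Opens E), H)}
    (A : H →L[ℝ] E →L[ℝ] F) (hf : ∀ x, fderiv ℝ f x = A (f' x))
    (h : ContDiff ℝ ∞ (translate f')) (n : ℕ) (y : E) :
    ‖iteratedFDeriv ℝ (n + 1) (translate f) y‖ ≤ ‖A‖ * ‖iteratedFDeriv ℝ n (translate f') y‖ := by
  rw [← norm_iteratedFDeriv_fderiv, fderiv_translate A hf]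
  calc ‖iteratedFDeriv ℝ n (fun y => -familyFlip A (translate f' y)) y‖
      = ‖iteratedFDeriv ℝ n (familyFlip A ∘ translate f') y‖ := by
        rw [← norm_neg (iteratedFDeriv ℝ n (familyFlip A ∘ translate f') y),
          ← iteratedFDeriv_neg_apply]
        rfl
    _ ≤ ‖familyFlip A‖ * ‖iteratedFDeriv ℝ n (translate f') y‖ :=
        (familyFlip A).norm_iteratedFDeriv_comp_left h.contDiffAt (mod_cast le_top)
    _ ≤ ‖A‖ * ‖iteratedFDeriv ℝ n (translate f') y‖ := by
        gcongr
        exact norm_familyFlip_le A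

theorem fderiv_eq_id_fderivCLM (f : 𝓓((⊤ : Opens E), F)) (x : E) :
    fderiv ℝ f x = ContinuousLinearMap.id ℝ (E →L[ℝ] F) (TestFunction.fderivCLM ℝ ⊤ ⊤ f x) := by
  simp

theorem contDiff_translate (f : 𝓓((⊤ : Opens E), F)) : ContDiff ℝ ∞ (translate f) := by
  refine contDiff_infty.2 fun n => ?_
  induction n generalizing F with
  | zero =>
    have h : Differentiable ℝ (translate f) := fun y =>
      (hasFDerivAt_translate _ (fderiv_eq_id_fderivCLM f) y).differentiableAt
    exact contDiff_zero.2 h.continuous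
  | succ n ih => exact contDiff_translate_succ _ (fderiv_eq_id_fderivCLM f) (ih _)

theorem norm_iteratedFDeriv_translate_le (f : 𝓓((⊤ : Opens E), F)) {n : ℕ} {C : ℝ}
    (hC : ∀ x, ‖iteratedFDeriv ℝ n f x‖ ≤ C) (y : E) :
    ‖iteratedFDeriv ℝ n (translate f) y‖ ≤ C := by
  induction n generalizing F with
  | zero =>
    simp only [norm_iteratedFDeriv_zero] at hC ⊢
    exact (BoundedContinuousFunction.norm_le ((norm_nonneg _).trans (hC 0))).2 fun x => hC _
  | succ n ih =>
    let f' := TestFunction.fderivCLM ℝ ⊤ ⊤ f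
    have hf' (x : E) : ‖iteratedFDeriv ℝ n f' x‖ ≤ C := by
      simpa [f', norm_iteratedFDeriv_fderiv] using hC x
    refine (norm_iteratedFDeriv_succ_translate_le _ (fderiv_eq_id_fderivCLM f)
      (contDiff_translate f') n y).trans ?_
    rw [← one_mul C]
    exact mul_le_mul ContinuousLinearMap.norm_id_le (ih f' hf') (norm_nonneg _) zero_le_one

end Translation

section Representation

theorem exists_eq_sum_continuousLinearMap {𝕜 W ι : Type*} {V : ι → Type*} [RCLike 𝕜]
    [AddCommGroup W] [Module 𝕜 W] [Fintype ι] [∀ i, NormedAddCommGroup (V i)]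
    [∀ i, NormedSpace 𝕜 (V i)] (T : W →ₗ[𝕜] 𝕜) (J : ∀ i, W →ₗ[𝕜] V i) {C : ℝ}
    (hT : ∀ w M, 0 ≤ M → (∀ i, ‖J i w‖ ≤ M) → ‖T w‖ ≤ C * M) :
    ∃ Λ : ∀ i, V i →L[𝕜] 𝕜, ∀ w, T w = ∑ i, Λ i (J i w) := by
  classical
  let J' : W →ₗ[𝕜] ∀ i, V i := LinearMap.pi J
  have hJ (w : W) : ‖T w‖ ≤ C * ‖J' w‖ := hT w _ (norm_nonneg _) (norm_le_pi_norm (J' w))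
  obtain ⟨S, hS⟩ := J'.rangeRestrict.exists_rightInverse_of_surjective J'.range_rangeRestrict
  have hJS (v : LinearMap.range J') : J' (S v) = v :=
    congrArg Subtype.val (LinearMap.congr_fun hS v)
  obtain ⟨Λ, hΛ, -⟩ := exists_extension_norm_eq _
    ((T ∘ₗ S).mkContinuous C fun v => (hJ (S v)).trans_eq (by rw [hJS]; rfl))
  have hΛJ (w : W) : Λ (J' w) = T w := by
    refine (hΛ (J'.rangeRestrict w)).trans (sub_eq_zero.1 (norm_le_zero_iff.1 ?_))
    change ‖T (S (J'.rangeRestrict w)) - T w‖ ≤ 0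
    rw [← map_sub]
    refine (hJ _).trans_eq ?_
    rw [map_sub, hJS, LinearMap.codRestrict_apply, sub_self, norm_zero, mul_zero]
  refine ⟨fun i => Λ.comp (ContinuousLinearMap.single 𝕜 V i), fun w => ?_⟩
  rw [← hΛJ, ← Finset.univ_sum_single (J' w), map_sum]
  rfl

variable {E F : Type*} [NormedAddCommGroup E] [NormedSpace ℝ E] [NormedAddCommGroup F]
  [NormedSpace ℝ F]

/-- The `i`-th derivative of a test function, as a test function. -/
noncomputable def iterDeriv (i : ℕ) (ψ : 𝓓((⊤ : Opens E), F)) :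
    𝓓((⊤ : Opens E), E [×i]→L[ℝ] F) where
  toFun := iteratedFDeriv ℝ i ψ
  contDiff' := contDiff_iteratedFDeriv ψ.contDiff i
  hasCompactSupport' := ψ.hasCompactSupport.iteratedFDeriv i
  tsupport_subset' := Set.subset_univ _

/-- The test function `x ↦ θ (y - x)` occurring in the convolution with `θ`. -/
def reflectAt (θ : 𝓓((⊤ : Opens E), F)) (y : E) : 𝓓((⊤ : Opens E), F) where
  toFun x := θ (y - x)
  contDiff' := θ.contDiff.comp (contDiff_const.sub contDiff_id)
  hasCompactSupport' := θ.hasCompactSupport.comp_homeomorph (Homeomorph.subLeft y)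
  tsupport_subset' := Set.subset_univ _

theorem norm_iteratedFDeriv_reflectAt_zero (i : ℕ) (θ : 𝓓((⊤ : Opens E), F)) (x : E) :
    ‖iteratedFDeriv ℝ i (reflectAt θ 0) x‖ = ‖iteratedFDeriv ℝ i θ (-x)‖ := by
  rw [← norm_iteratedFDeriv_comp_neg]
  simp only [reflectAt, zero_sub]
  rfl

/-- The map `ψ ↦ D^i ψ` from test functions to bounded continuous functions. -/
noncomputable def iterDerivₗ (i : ℕ) :
    𝓓((⊤ : Opens E), ℂ) →ₗ[ℂ] E →ᵇ E [×i]→L[ℝ] ℂ where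
  toFun ψ := iterDeriv i ψ
  map_add' ψ φ := by
    ext1 x
    exact iteratedFDeriv_add_apply (ψ.contDiff.of_le (mod_cast le_top)).contDiffAt
      (φ.contDiff.of_le (mod_cast le_top)).contDiffAt
  map_smul' c ψ := by
    ext1 x
    exact iteratedFDeriv_const_smul_apply (ψ.contDiff.of_le (mod_cast le_top)).contDiffAt

theorem iterDerivₗ_reflectAt (i : ℕ) (θ : 𝓓((⊤ : Opens E), ℂ)) (y : E) :
    iterDerivₗ i (reflectAt θ y) = translate (iterDeriv i (reflectAt θ 0)) y := by
  ext1 x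
  have h : ⇑(reflectAt θ y) = fun x => reflectAt θ 0 (x - y) :=
    funext fun x => congrArg θ (by simp [sub_eq_add_neg, add_comm])
  change iteratedFDeriv ℝ i (reflectAt θ y) x = iteratedFDeriv ℝ i (reflectAt θ 0) (x - y)
  rw [h, iteratedFDeriv_comp_sub]

variable {d : ℕ} {Ω : Opens (EuclideanSpace ℝ (Fin d))}

theorem Distr.exists_bound (T : Distr Ω) {K : Set (EuclideanSpace ℝ (Fin d))} (hK : IsCompact K)
    (hKΩ : K ⊆ Ω) : ∃ (N : ℕ) (C : ℝ), ∀ f : 𝓓(Ω, ℂ), (∀ x ∉ K, f x = 0) →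
      ∀ M : ℝ, (∀ i ≤ N, ∀ x, ‖iteratedFDeriv ℝ i f x‖ ≤ M) → ‖T f‖ ≤ C * M := by
  let K' : Compacts (EuclideanSpace ℝ (Fin d)) := ⟨K, hK⟩
  let S : 𝓓_{K'}(EuclideanSpace ℝ (Fin d), ℂ) →L[ℂ] ℂ :=
    T.comp (TestFunction.ofSupportedInCLM ℂ hKΩ)
  obtain ⟨s, C, -, hC⟩ := Seminorm.bound_of_continuous
    (ContDiffMapSupportedIn.withSeminorms ℂ (EuclideanSpace ℝ (Fin d)) ℂ ⊤ K')
    ((normSeminorm ℂ ℂ).comp S.toLinearMap) (continuous_norm.comp S.continuous)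
  refine ⟨s.sup id, C, fun f hf M hM => ?_⟩
  have hM0 : 0 ≤ M := (norm_nonneg _).trans (hM 0 (Nat.zero_le _) 0)
  let g : 𝓓_{K'}(EuclideanSpace ℝ (Fin d), ℂ) :=
    ContDiffMapSupportedIn.of_support_subset f.contDiff fun x hx => by_contra fun h => hx (hf x h)
  have hgM : s.sup (ContDiffMapSupportedIn.seminorm ℂ (EuclideanSpace ℝ (Fin d)) ℂ ⊤ K') g ≤ M :=
    Seminorm.finset_sup_apply_le hM0 fun i hi =>
      (ContDiffMapSupportedIn.seminorm_top_le_iff ℂ hM0 i g).2 fun x _ =>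
        hM i (Finset.le_sup (f := id) hi) x
  have hTf : ‖T f‖ = ((normSeminorm ℂ ℂ).comp S.toLinearMap) g := rfl
  exact hTf.trans_le ((hC g).trans (mul_le_mul_of_nonneg_left hgM C.2))

/-- The linear form `ψ ↦ ⟨κT, ψ⟩ = ⟨T, κψ⟩` on test functions. -/
noncomputable def cutForm (κ : 𝓓(Ω, ℝ)) (T : Distr Ω) :
    𝓓((⊤ : Opens (EuclideanSpace ℝ (Fin d))), ℂ) →ₗ[ℂ] ℂ where
  toFun ψ := T (cutMul κ ψ ψ.contDiff)
  map_add' ψ φ := by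
    rw [← map_add]
    exact congrArg T (TestFunction.ext fun x => smul_add (κ x) (ψ x) (φ x))
  map_smul' c ψ := by
    rw [← map_smul]
    exact congrArg T (TestFunction.ext fun x => smul_comm (κ x) c (ψ x))

theorem exists_norm_cutForm_le (κ : 𝓓(Ω, ℝ)) (T : Distr Ω) :
    ∃ (N : ℕ) (C : ℝ), ∀ (ψ : 𝓓((⊤ : Opens (EuclideanSpace ℝ (Fin d))), ℂ)) (M : ℝ),
      (∀ i ≤ N, ∀ x, ‖iteratedFDeriv ℝ i ψ x‖ ≤ M) → ‖cutForm κ T ψ‖ ≤ C * M := by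
  obtain ⟨N, C, hT⟩ := T.exists_bound κ.hasCompactSupport.isCompact κ.tsupport_subset
  obtain ⟨A, hA⟩ := exists_norm_iteratedFDeriv_testFunction_le κ N
  have hA0 : 0 ≤ A := (norm_nonneg _).trans (hA 0 (Nat.zero_le N) 0)
  refine ⟨N, C * (2 ^ N * A), fun ψ M hψ => ?_⟩
  have hM : 0 ≤ M := (norm_nonneg _).trans (hψ 0 (Nat.zero_le N) 0)
  rw [mul_assoc, mul_assoc]
  refine hT (cutMul κ ψ ψ.contDiff) (fun x hx => ?_) _ fun i hi x => ?_
  · change κ x • ψ x = 0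
    rw [image_eq_zero_of_notMem_tsupport hx, zero_smul]
  · calc ‖iteratedFDeriv ℝ i (fun x => κ x • ψ x) x‖
        ≤ 2 ^ i * (A * M) := norm_iteratedFDeriv_smul_le_of_forall_le κ.contDiff ψ.contDiff
          (mod_cast le_top) (fun j hj => hA j (hj.trans hi) x) fun j hj => hψ j (hj.trans hi) x
      _ ≤ 2 ^ N * (A * M) := by
        gcongr
        exact one_le_two

theorem exists_cutForm_eq_sum (κ : 𝓓(Ω, ℝ)) (T : Distr Ω) :
    ∃ (N : ℕ) (Λ : ∀ i : Fin N, (EuclideanSpace ℝ (Fin d) →ᵇ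
      EuclideanSpace ℝ (Fin d) [×(i : ℕ)]→L[ℝ] ℂ) →L[ℂ] ℂ),
      ∀ ψ, cutForm κ T ψ = ∑ i, Λ i (iterDerivₗ i ψ) := by
  obtain ⟨N, C, hC⟩ := exists_norm_cutForm_le κ T
  exact ⟨N + 1, exists_eq_sum_continuousLinearMap (V := fun i : Fin (N + 1) =>
    EuclideanSpace ℝ (Fin d) →ᵇ EuclideanSpace ℝ (Fin d) [×(i : ℕ)]→L[ℝ] ℂ)
    (cutForm κ T) (fun i => iterDerivₗ i) fun ψ M _ hψ => hC ψ M fun i hi x =>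
      ((iterDerivₗ i ψ).norm_coe_le_norm x).trans (hψ ⟨i, Nat.lt_succ_of_le hi⟩)⟩

theorem cutConv_eq_cutForm (κ : 𝓓(Ω, ℝ)) (T : Distr Ω)
    (θ : 𝓓((⊤ : Opens (EuclideanSpace ℝ (Fin d))), ℂ)) (y : EuclideanSpace ℝ (Fin d)) :
    cutConv κ T θ θ.contDiff y = cutForm κ T (reflectAt θ y) := rfl

theorem exists_cutConv_eq_sum (κ : 𝓓(Ω, ℝ)) (T : Distr Ω) :
    ∃ (N : ℕ) (Λ : ∀ i : Fin N, (EuclideanSpace ℝ (Fin d) →ᵇ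
      EuclideanSpace ℝ (Fin d) [×(i : ℕ)]→L[ℝ] ℂ) →L[ℂ] ℂ),
      (∀ ψ, cutForm κ T ψ = ∑ i, Λ i (iterDerivₗ i ψ)) ∧
      ∀ θ : 𝓓((⊤ : Opens (EuclideanSpace ℝ (Fin d))), ℂ), cutConv κ T θ θ.contDiff =
        fun y => ∑ i, Λ i (translate (iterDeriv i (reflectAt θ 0)) y) := by
  obtain ⟨N, Λ, hΛ⟩ := exists_cutForm_eq_sum κ T
  refine ⟨N, Λ, hΛ, fun θ => funext fun y => ?_⟩
  simp only [cutConv_eq_cutForm, hΛ, iterDerivₗ_reflectAt]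

end Representation

section Functional

variable {E F : Type u} [NormedAddCommGroup E] [NormedSpace ℝ E] [NormedAddCommGroup F]
  [NormedSpace ℝ F] [NormedSpace ℂ F] (Λ : (E →ᵇ F) →L[ℂ] ℂ)
  (f : 𝓓((⊤ : Opens E), F))

theorem contDiff_clm_translate [IsScalarTower ℝ ℂ F] : ContDiff ℝ ∞ fun y => Λ (translate f y) :=
  (Λ.restrictScalars ℝ).contDiff.comp (contDiff_translate f)

theorem exists_norm_iteratedFDeriv_clm_translate_le [IsScalarTower ℝ ℂ F] :
    ∃ B, ∀ (f : 𝓓((⊤ : Opens E), F)) (n : ℕ) (C : ℝ), (∀ x, ‖iteratedFDeriv ℝ n f x‖ ≤ C) →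
      ∀ y, ‖iteratedFDeriv ℝ n (fun y => Λ (translate f y)) y‖ ≤ B * C :=
  ⟨‖Λ.restrictScalars ℝ‖, fun f _ _ hC y =>
    ((Λ.restrictScalars ℝ).norm_iteratedFDeriv_comp_left (contDiff_translate f).contDiffAt
      (mod_cast le_top)).trans
        (mul_le_mul_of_nonneg_left (norm_iteratedFDeriv_translate_le f hC y) (norm_nonneg _))⟩

theorem integral_mul_clm_translate [CompleteSpace F] [MeasurableSpace E] [BorelSpace E]
    {μ : Measure E} [IsFiniteMeasureOnCompacts μ] {φ : E → ℂ} (hφ : Continuous φ)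
    (hφc : HasCompactSupport φ) {g : E →ᵇ F} (hg : ∀ x, g x = ∫ y, φ y • f (x - y) ∂μ) :
    ∫ y, φ y * Λ (translate f y) ∂μ = Λ g := by
  have hint : Integrable (fun y => φ y • translate f y) μ :=
    (hφ.smul (contDiff_translate f).continuous).integrable_of_hasCompactSupport hφc.smul_right
  have hg' : g = ∫ y, φ y • translate f y ∂μ := by
    ext1 x
    exact (hg x).trans ((BoundedContinuousFunction.evalCLM ℂ x).integral_comp_comm hint)
  rw [hg', ← Λ.integral_comp_comm hint]
  simp only [map_smul, smul_eq_mul]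

end Functional

section CutoffConvolution

variable {d : ℕ} {Ω : Opens (EuclideanSpace ℝ (Fin d))} (κ : 𝓓(Ω, ℝ)) (T : Distr Ω)

theorem contDiff_cutConv_testFunction (θ : 𝓓((⊤ : Opens (EuclideanSpace ℝ (Fin d))), ℂ)) :
    ContDiff ℝ ∞ (cutConv κ T θ θ.contDiff) := by
  obtain ⟨N, Λ, -, hΛ⟩ := exists_cutConv_eq_sum κ T
  rw [hΛ]
  exact ContDiff.sum fun i _ => contDiff_clm_translate (Λ i) _

theorem exists_norm_iteratedFDeriv_cutConv_le :
    ∃ (N : ℕ) (C : ℝ), ∀ (θ : 𝓓((⊤ : Opens (EuclideanSpace ℝ (Fin d))), ℂ)) (n : ℕ) (M : ℝ),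
      (∀ i ≤ N + n, ∀ x, ‖iteratedFDeriv ℝ i θ x‖ ≤ M) →
      ∀ y, ‖iteratedFDeriv ℝ n (cutConv κ T θ θ.contDiff) y‖ ≤ C * M := by
  obtain ⟨N, Λ, -, hΛ⟩ := exists_cutConv_eq_sum κ T
  choose B hB using fun i => exists_norm_iteratedFDeriv_clm_translate_le (Λ i)
  refine ⟨N, ∑ i, B i, fun θ n M hM y => ?_⟩
  rw [hΛ, iteratedFDeriv_sum fun i _ =>
    ((contDiff_clm_translate (Λ i) _).of_le (mod_cast le_top)), Finset.sum_apply, Finset.sum_mul]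
  refine norm_sum_le_of_le _ fun i _ => hB i _ n M (fun x => ?_) y
  change ‖iteratedFDeriv ℝ n (iteratedFDeriv ℝ i (reflectAt θ 0)) x‖ ≤ M
  rw [norm_iteratedFDeriv_iteratedFDeriv, norm_iteratedFDeriv_reflectAt_zero]
  exact hM _ (by omega) _

/-- The convolution of two test functions, as a test function. -/
noncomputable def testConv (φ ψ : 𝓓((⊤ : Opens (EuclideanSpace ℝ (Fin d))), ℂ)) :
    𝓓((⊤ : Opens (EuclideanSpace ℝ (Fin d))), ℂ) :=
  ⟨φ ⋆[ContinuousLinearMap.mul ℝ ℂ] ψ,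
    ψ.hasCompactSupport.contDiff_convolution_right (n := ⊤) (.mul ℝ ℂ)
      φ.continuous.locallyIntegrable ψ.contDiff,
    φ.hasCompactSupport.convolution (.mul ℝ ℂ) ψ.hasCompactSupport, Set.subset_univ _⟩

theorem iterDerivₗ_testConv_apply (φ ψ : 𝓓((⊤ : Opens (EuclideanSpace ℝ (Fin d))), ℂ)) (i : ℕ)
    (x : EuclideanSpace ℝ (Fin d)) :
    iterDerivₗ i (testConv φ ψ) x = ∫ y, φ y • iterDeriv i ψ (x - y) := by
  ext m
  have hint : Integrable fun y => φ y • iterDeriv i ψ (x - y) :=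
    (φ.continuous.smul ((iterDeriv i ψ).continuous.comp (continuous_const.sub continuous_id))
      ).integrable_of_hasCompactSupport φ.hasCompactSupport.smul_right
  rw [ContinuousMultilinearMap.integral_apply hint]
  exact iteratedFDeriv_convolution_right_apply _ φ.continuous.locallyIntegrable ψ.contDiff
    ψ.hasCompactSupport m x

/-- This exchanges a distribution and an integral: `φ • translate` is integrable with values in the
bounded continuous functions, hence its integral commutes with the functionals representing `κT`. -/
theorem integral_mul_cutConv (φ θ : 𝓓((⊤ : Opens (EuclideanSpace ℝ (Fin d))), ℂ)) :
    ∫ y, φ y * cutConv κ T θ θ.contDiff y = cutForm κ T (testConv φ (reflectAt θ 0)) := by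
  obtain ⟨N, Λ, hΛ, hΛ'⟩ := exists_cutConv_eq_sum κ T
  have hint (i : Fin N) :
      Integrable fun y => φ y * Λ i (translate (iterDeriv i (reflectAt θ 0)) y) :=
    (φ.continuous.mul (contDiff_clm_translate (Λ i) _).continuous).integrable_of_hasCompactSupport
      φ.hasCompactSupport.mul_right
  simp only [hΛ, hΛ', Finset.mul_sum]
  rw [integral_finsetSum _ fun i _ => hint i]
  exact Finset.sum_congr rfl fun i _ => integral_mul_clm_translate (Λ i) _ φ.continuous
    φ.hasCompactSupport (iterDerivₗ_testConv_apply φ _ i)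

end CutoffConvolution

section Mollifier

variable {d : ℕ} {θ : Set.Ioc (0 : ℝ) 1 → EuclideanSpace ℝ (Fin d) → ℂ}

/-- Nets of mollifiers of infinite order: smooth functions with supports shrinking to the origin,
derivatives growing at most polynomially in `ε⁻¹`, and such that convolution with `θ ε` is an
approximation of the identity to every order `ε ^ p`, uniformly over test functions bounded in a
suitable `C^n` norm. These are the properties of `theta ρ χ` on which the embedding rests. -/
structure IsMollifierNet (θ : Set.Ioc (0 : ℝ) 1 → EuclideanSpace ℝ (Fin d) → ℂ) : Prop where
  contDiff : ∀ ε, ContDiff ℝ ∞ (θ ε)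
  eventually_norm_le : ∀ r : ℝ, 0 < r → ∀ᶠ ε in atZero, ∀ x, θ ε x ≠ 0 → ‖x‖ ≤ r
  eventually_norm_iteratedFDeriv_le : ∀ N : ℕ, ∃ (q : ℕ) (C : ℝ), ∀ᶠ ε in atZero, ∀ i ≤ N, ∀ x,
    ‖iteratedFDeriv ℝ i (θ ε) x‖ ≤ C * ((ε : ℝ) ^ q)⁻¹
  eventually_norm_convolution_sub_le : ∀ p : ℕ, ∃ (n : ℕ) (C : ℝ), ∀ᶠ ε in atZero,
    ∀ (u : 𝓓((⊤ : Opens (EuclideanSpace ℝ (Fin d))), ℂ)) (A : ℝ),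
      (∀ i ≤ n, ∀ x, ‖iteratedFDeriv ℝ i u x‖ ≤ A) →
      ∀ y, ‖(θ ε ⋆[ContinuousLinearMap.mul ℝ ℂ] u) y - u y‖ ≤ C * A * (ε : ℝ) ^ p

theorem IsMollifierNet.eventually_hasCompactSupport (hθ : IsMollifierNet θ) :
    ∀ᶠ ε in atZero, HasCompactSupport (θ ε) :=
  (hθ.eventually_norm_le 1 one_pos).mono fun _ h =>
    HasCompactSupport.intro (isCompact_closedBall 0 1) fun x hx =>
      by_contra fun h0 => hx (mem_closedBall_zero_iff.2 (h x h0))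

/-- The directional derivative `x ↦ D^i u x m` of a test function, as a test function. -/
noncomputable def iterDerivApply (u : 𝓓((⊤ : Opens (EuclideanSpace ℝ (Fin d))), ℂ)) {i : ℕ}
    (m : Fin i → EuclideanSpace ℝ (Fin d)) : 𝓓((⊤ : Opens (EuclideanSpace ℝ (Fin d))), ℂ) :=
  ⟨fun x => iteratedFDeriv ℝ i u x m, contDiff_iteratedFDeriv_apply u.contDiff m,
    (u.hasCompactSupport.iteratedFDeriv i).comp_left
      (g := fun L : EuclideanSpace ℝ (Fin d) [×i]→L[ℝ] ℂ => L m) rfl, Set.subset_univ _⟩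

theorem IsMollifierNet.eventually_norm_iteratedFDeriv_convolution_sub_le (hθ : IsMollifierNet θ)
    (u : 𝓓((⊤ : Opens (EuclideanSpace ℝ (Fin d))), ℂ)) (l p : ℕ) :
    ∃ C : ℝ, ∀ᶠ ε in atZero, ∀ i ≤ l, ∀ y,
      ‖iteratedFDeriv ℝ i (θ ε ⋆[ContinuousLinearMap.mul ℝ ℂ] u) y - iteratedFDeriv ℝ i u y‖ ≤
        C * (ε : ℝ) ^ p := by
  obtain ⟨n, C, hC⟩ := hθ.eventually_norm_convolution_sub_le p
  obtain ⟨A, hA⟩ := exists_norm_iteratedFDeriv_testFunction_le u (l + n)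
  refine ⟨max C 0 * A, hC.mono fun ε hε i hi y => ?_⟩
  have hA0 : 0 ≤ A := (norm_nonneg _).trans (hA 0 (Nat.zero_le _) 0)
  have hε0 : (0 : ℝ) < ε := ε.2.1
  refine ContinuousMultilinearMap.opNorm_le_bound (by positivity) fun m => ?_
  let um := iterDerivApply u m
  have hum (k : ℕ) (hk : k ≤ n) (x : EuclideanSpace ℝ (Fin d)) :
      ‖iteratedFDeriv ℝ k um x‖ ≤ A * ∏ j, ‖m j‖ :=
    (norm_iteratedFDeriv_iteratedFDeriv_apply_le u.contDiff k m x).trans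
      (mul_le_mul_of_nonneg_right (hA _ (add_le_add hi hk) x) (by positivity))
  rw [sub_apply, iteratedFDeriv_convolution_right_apply _
    (hθ.contDiff ε).continuous.locallyIntegrable u.contDiff u.hasCompactSupport]
  calc _ ≤ C * (A * ∏ j, ‖m j‖) * (ε : ℝ) ^ p := hε um _ hum y
    _ ≤ max C 0 * (A * ∏ j, ‖m j‖) * (ε : ℝ) ^ p := by
        gcongr
        exact le_max_left C 0
    _ = max C 0 * A * (ε : ℝ) ^ p * ∏ j, ‖m j‖ := by ring

end Mollifier

section Taylor

open scoped Nat

variable {E F : Type*} [NormedAddCommGroup E] [NormedSpace ℝ E] [NormedAddCommGroup F]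
  [NormedSpace ℝ F]

/-- The Taylor polynomial of degree `n` of `u` at `y`, evaluated at the increment `v`. -/
noncomputable def taylorPoly (u : E → F) (n : ℕ) (y v : E) : F :=
  ∑ k ∈ Finset.range (n + 1), (k ! : ℝ)⁻¹ • iteratedFDeriv ℝ k u y fun _ => v

theorem norm_sub_taylorPoly_le [CompleteSpace F] {u : E → F} {n : ℕ}
    (hu : ContDiff ℝ (n + 1) u) {A : ℝ} (hA : ∀ x, ‖iteratedFDeriv ℝ (n + 1) u x‖ ≤ A) (y v : E) :
    ‖u (y + v) - taylorPoly u n y v‖ ≤ A * ‖v‖ ^ (n + 1) := by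
  have hbound (t : ℝ) (ht : t ∈ Set.uIoc (0 : ℝ) 1) :
      ‖(1 - t) ^ n • iteratedFDeriv ℝ (n + 1) u (y + t • v) fun _ => v‖ ≤ A * ‖v‖ ^ (n + 1) := by
    rw [Set.uIoc_of_le zero_le_one] at ht
    rw [norm_smul, norm_pow, Real.norm_of_nonneg (sub_nonneg.2 ht.2)]
    refine (mul_le_of_le_one_left (norm_nonneg _)
      (pow_le_one₀ (sub_nonneg.2 ht.2) (sub_le_self _ ht.1.le))).trans ?_
    refine (ContinuousMultilinearMap.le_opNorm _ _).trans ?_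
    rw [Finset.prod_const, Finset.card_univ, Fintype.card_fin]
    gcongr
    exact hA _
  have hint := intervalIntegral.norm_integral_le_of_norm_le_const hbound
  rw [sub_zero, abs_one, mul_one] at hint
  rw [map_add_eq_sum_add_integral_iteratedFDeriv fun _ _ => hu.contDiffAt, taylorPoly,
    add_sub_cancel_left, norm_smul, norm_inv, Real.norm_natCast]
  exact (mul_le_of_le_one_left (norm_nonneg _)
    (inv_le_one_of_one_le₀ (mod_cast Nat.one_le_iff_ne_zero.2 n.factorial_ne_zero))).trans hint

theorem taylorPoly_smul (u : E → F) (n : ℕ) (y v : E) (a : ℝ) :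
    taylorPoly u n y (a • v) =
      ∑ k ∈ Finset.range (n + 1), ((k ! : ℝ)⁻¹ * a ^ k) • iteratedFDeriv ℝ k u y fun _ => v := by
  refine Finset.sum_congr rfl fun k _ => ?_
  rw [(iteratedFDeriv ℝ k u y).map_smul_univ (fun _ => a) fun _ => v, Finset.prod_const,
    Finset.card_univ, Fintype.card_fin, smul_smul]

theorem norm_mul_sub_taylorPoly_le {u : E → ℂ} {n : ℕ} (hu : ContDiff ℝ (n + 1) u) {A s : ℝ}
    (hA : ∀ i ≤ n + 1, ∀ x, ‖iteratedFDeriv ℝ i u x‖ ≤ A) {a : ℂ} (ha : ‖a - 1‖ ≤ s) (y v : E) :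
    ‖a * u (y + v) - taylorPoly u n y v‖ ≤ (s + ‖v‖ ^ (n + 1)) * A := by
  have hA0 : ‖u (y + v)‖ ≤ A := by
    simpa only [norm_iteratedFDeriv_zero] using hA 0 (Nat.zero_le _) (y + v)
  calc ‖a * u (y + v) - taylorPoly u n y v‖
      = ‖(a - 1) * u (y + v) + (u (y + v) - taylorPoly u n y v)‖ := by ring_nf
    _ ≤ s * A + A * ‖v‖ ^ (n + 1) := by
        refine (norm_add_le _ _).trans
          (add_le_add ?_ (norm_sub_taylorPoly_le hu (hA _ le_rfl) y v))
        rw [norm_mul]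
        exact mul_le_mul ha hA0 (norm_nonneg _) ((norm_nonneg _).trans ha)
    _ = (s + ‖v‖ ^ (n + 1)) * A := by ring

end Taylor

section Moments

open scoped Nat

variable {d : ℕ} {ρ : 𝓢(EuclideanSpace ℝ (Fin d), ℂ)}

theorem integrable_schwartz_mul_multilinear {E : Type*} [NormedAddCommGroup E] [NormedSpace ℝ E]
    [MeasurableSpace E] [BorelSpace E] [SecondCountableTopology E] {μ : Measure E}
    [μ.HasTemperateGrowth] (ρ : 𝓢(E, ℂ)) {k : ℕ} (M : E [×k]→L[ℝ] ℂ) :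
    Integrable (fun z => ρ z * M fun _ => z) μ := by
  refine ((ρ.integrable_pow_mul μ k).const_mul ‖M‖).mono'
    (ρ.continuous.mul (M.cont.comp (continuous_pi fun _ => continuous_id))).aestronglyMeasurable
    (.of_forall fun z => ?_)
  calc ‖ρ z * M fun _ => z‖ ≤ ‖ρ z‖ * (‖M‖ * ∏ _ : Fin k, ‖z‖) := by
        rw [norm_mul]
        gcongr
        exact M.le_opNorm _
    _ = ‖M‖ * (‖z‖ ^ k * ‖ρ z‖) := by
        rw [Finset.prod_const, Finset.card_univ, Fintype.card_fin]
        ring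

theorem integrable_monomial_mul_schwartz (ρ : 𝓢(EuclideanSpace ℝ (Fin d), ℂ)) (m : Fin d → ℕ) :
    Integrable fun x : EuclideanSpace ℝ (Fin d) => (∏ i, ((x i : ℝ) : ℂ) ^ m i) * ρ x := by
  refine (ρ.integrable_pow_mul volume (∑ i, m i)).mono'
    (Continuous.aestronglyMeasurable (by fun_prop)) (.of_forall fun x => ?_)
  rw [norm_mul, norm_prod, ← Finset.prod_pow_eq_pow_sum]
  gcongr with i
  rw [norm_pow, Complex.norm_real]
  gcongr
  exact PiLp.norm_apply_le x i

theorem multilinear_diag_eq_sum_monomial {k : ℕ} (M : EuclideanSpace ℝ (Fin d) [×k]→L[ℝ] ℂ)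
    (z : EuclideanSpace ℝ (Fin d)) :
    (M fun _ => z) = ∑ r : Fin k → Fin d,
      (∏ i, ((z i : ℝ) : ℂ) ^ (Finset.univ.filter fun j => r j = i).card) *
        M fun j => EuclideanSpace.single (r j) 1 := by
  have hz : ∑ i, z i • EuclideanSpace.single i (1 : ℝ) = z := by
    simpa only [EuclideanSpace.basisFun_repr, EuclideanSpace.basisFun_apply] using
      (EuclideanSpace.basisFun (Fin d) ℝ).sum_repr z
  conv_lhs => rw [← hz]
  rw [ContinuousMultilinearMap.map_sum]
  refine Finset.sum_congr rfl fun r _ => ?_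
  rw [ContinuousMultilinearMap.map_smul_univ, Complex.real_smul, Complex.ofReal_prod,
    ← Finset.prod_fiberwise' Finset.univ r fun i => ((z i : ℝ) : ℂ)]
  simp only [Finset.prod_const]

theorem integral_schwartz_mul_multilinear_eq_zero
    (hρ_mom : ∀ m : Fin d → ℕ, m ≠ 0 → ∫ x, (∏ i, ((x i : ℝ) : ℂ) ^ m i) * ρ x = 0)
    {k : ℕ} (hk : k ≠ 0) (M : EuclideanSpace ℝ (Fin d) [×k]→L[ℝ] ℂ) :
    ∫ z : EuclideanSpace ℝ (Fin d), ρ z * (M fun _ => z) = 0 := by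
  simp only [multilinear_diag_eq_sum_monomial M, mul_comm (ρ _), Finset.sum_mul,
    mul_right_comm _ _ (ρ _)]
  rw [integral_finsetSum _ fun r _ => (integrable_monomial_mul_schwartz ρ _).mul_const _]
  refine Finset.sum_eq_zero fun r _ => ?_
  let j : Fin k := ⟨0, Nat.pos_of_ne_zero hk⟩
  have hr : (fun i => (Finset.univ.filter fun j => r j = i).card) ≠ 0 := fun h =>
    (Finset.card_ne_zero_of_mem (Finset.mem_filter.2 ⟨Finset.mem_univ j, rfl⟩) :
      (Finset.univ.filter fun i => r i = r j).card ≠ 0) (congrFun h (r j))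
  rw [integral_mul_const, hρ_mom _ hr, zero_mul]

theorem integrable_schwartz_mul_taylorPoly (ρ : 𝓢(EuclideanSpace ℝ (Fin d), ℂ))
    (u : EuclideanSpace ℝ (Fin d) → ℂ) (n : ℕ) (y : EuclideanSpace ℝ (Fin d)) (a : ℝ) :
    Integrable fun z => ρ z * taylorPoly u n y (a • z) := by
  simp only [taylorPoly_smul, Finset.mul_sum, mul_smul_comm]
  exact integrable_finsetSum _ fun k _ => (integrable_schwartz_mul_multilinear ρ _).smul _

theorem integral_schwartz_mul_taylorPoly (hρ_int : ∫ x, ρ x = 1)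
    (hρ_mom : ∀ m : Fin d → ℕ, m ≠ 0 → ∫ x, (∏ i, ((x i : ℝ) : ℂ) ^ m i) * ρ x = 0)
    (u : EuclideanSpace ℝ (Fin d) → ℂ) (n : ℕ) (y : EuclideanSpace ℝ (Fin d)) (a : ℝ) :
    ∫ z, ρ z * taylorPoly u n y (a • z) = u y := by
  simp only [taylorPoly_smul, Finset.mul_sum, mul_smul_comm]
  rw [integral_finsetSum _ fun k _ => (integrable_schwartz_mul_multilinear ρ _).fun_smul _,
    Finset.sum_eq_single_of_mem 0 (Finset.mem_range.2 n.succ_pos) fun k _ hk => by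
      rw [integral_smul, integral_schwartz_mul_multilinear_eq_zero hρ_mom hk, smul_zero]]
  simp only [Nat.factorial_zero, Nat.cast_one, inv_one, pow_zero, mul_one, one_smul,
    iteratedFDeriv_zero_apply, integral_mul_const, hρ_int, one_mul]

end Moments

section Theta

variable {d : ℕ} {ρ : 𝓢(EuclideanSpace ℝ (Fin d), ℂ)}
  {χ : 𝓓((⊤ : Opens (EuclideanSpace ℝ (Fin d))), ℝ)} {ε : Set.Ioc (0 : ℝ) 1}

theorem sq_abs_log_mul_self_le {t : ℝ} (h0 : 0 < t) (h1 : t ≤ 1) :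
    (|Real.log t| * t) ^ 2 ≤ 4 * t := by
  have h := (Real.abs_log_mul_self_rpow_lt t (1 / 2) h0 h1 one_half_pos).le
  rw [abs_mul, ← Real.sqrt_eq_rpow, abs_of_nonneg (Real.sqrt_nonneg t), one_div_one_div] at h
  calc (|Real.log t| * t) ^ 2 = (|Real.log t| * √t) ^ 2 * t := by
        rw [mul_pow, mul_pow, Real.sq_sqrt h0.le]
        ring
    _ ≤ 2 ^ 2 * t := by gcongr
    _ = 4 * t := by norm_num

theorem exists_norm_sub_one_le_mul_pow (hχ_one : ∀ x, ‖x‖ ≤ 1 → χ x = 1) :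
    ∃ c : ℝ, 0 ≤ c ∧ ∀ (n : ℕ) (x : EuclideanSpace ℝ (Fin d)),
      ‖((χ x : ℝ) : ℂ) - 1‖ ≤ c * ‖x‖ ^ n := by
  obtain ⟨B, hB⟩ := exists_norm_iteratedFDeriv_testFunction_le χ 0
  have hχ (x : EuclideanSpace ℝ (Fin d)) : ‖χ x‖ ≤ B := by
    simpa only [norm_iteratedFDeriv_zero] using hB 0 le_rfl x
  have hB0 : 0 ≤ B := (norm_nonneg _).trans (hχ 0)
  refine ⟨B + 1, by positivity, fun n x => ?_⟩
  by_cases hx : ‖x‖ ≤ 1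
  · rw [hχ_one x hx, Complex.ofReal_one, sub_self, norm_zero]
    positivity
  · calc ‖((χ x : ℝ) : ℂ) - 1‖ ≤ ‖((χ x : ℝ) : ℂ)‖ + ‖(1 : ℂ)‖ := norm_sub_le _ _
      _ ≤ B + 1 := by
          rw [Complex.norm_real, norm_one]
          gcongr
          exact hχ x
      _ ≤ (B + 1) * ‖x‖ ^ n := le_mul_of_one_le_right (by positivity) (one_le_pow₀ (not_le.1 hx).le)

theorem convolution_theta_apply (hε : (ε : ℝ) ≠ 1) (u : EuclideanSpace ℝ (Fin d) → ℂ)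
    (y : EuclideanSpace ℝ (Fin d)) :
    (theta ρ χ ε ⋆[ContinuousLinearMap.mul ℝ ℂ] u) y =
      ∫ z, ρ z * (((χ ((|Real.log ε| * ε) • z) : ℝ) : ℂ) * u (y + (-ε : ℝ) • z)) := by
  have h0 : (0 : ℝ) < ε := ε.2.1
  have h := Measure.integral_comp_smul_of_nonneg volume
    (fun t => theta ρ χ ε t * u (y - t)) (ε : ℝ) (hR := h0.le)
  rw [finrank_euclideanSpace_fin, ← inv_smul_eq_iff₀ (by positivity), inv_inv] at h
  change ∫ t, theta ρ χ ε t * u (y - t) = _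
  rw [← h, ← integral_smul]
  refine integral_congr_ae (.of_forall fun z => ?_)
  have hd : (((ε : ℝ) ^ d : ℝ) : ℂ) ≠ 0 := mod_cast (pow_pos h0 d).ne'
  simp only [theta, hε, if_false, smul_smul, inv_mul_cancel₀ h0.ne', one_smul, neg_smul,
    ← sub_eq_add_neg, Complex.real_smul, Complex.ofReal_inv]
  field_simp

theorem integrable_schwartz_mul_cutoff_mul (ρ : 𝓢(EuclideanSpace ℝ (Fin d), ℂ))
    (χ : 𝓓((⊤ : Opens (EuclideanSpace ℝ (Fin d))), ℝ))
    (u : 𝓓((⊤ : Opens (EuclideanSpace ℝ (Fin d))), ℂ)) (y : EuclideanSpace ℝ (Fin d)) (a b : ℝ) :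
    Integrable fun z => ρ z * (((χ (a • z) : ℝ) : ℂ) * u (y + b • z)) := by
  obtain ⟨A, hA⟩ := exists_norm_iteratedFDeriv_testFunction_le χ 0
  obtain ⟨B, hB⟩ := exists_norm_iteratedFDeriv_testFunction_le u 0
  simp only [nonpos_iff_eq_zero, forall_eq, norm_iteratedFDeriv_zero] at hA hB
  have hχ := χ.continuous
  have hu := u.continuous
  refine ρ.integrable.mul_bdd (c := A * B) (Continuous.aestronglyMeasurable (by fun_prop))
    (.of_forall fun z => ?_)
  rw [norm_mul, Complex.norm_real]
  exact mul_le_mul (hA _) (hB _) (norm_nonneg _) ((norm_nonneg _).trans (hA 0))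

/-- The moments of `ρ` cancel the Taylor polynomial of `u`; the cutoff `χ (x |log ε|)` differs from
`1` only where `‖x‖` is at least `|log ε|⁻¹`, which costs a power of `|log ε| * ε`. -/
theorem norm_convolution_theta_sub_le (hρ_int : ∫ x, ρ x = 1)
    (hρ_mom : ∀ m : Fin d → ℕ, m ≠ 0 → ∫ x, (∏ i, ((x i : ℝ) : ℂ) ^ m i) * ρ x = 0)
    {c : ℝ} {n : ℕ} (hχ : ∀ x, ‖((χ x : ℝ) : ℂ) - 1‖ ≤ c * ‖x‖ ^ (n + 1)) (hε : (ε : ℝ) ≠ 1)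
    (u : 𝓓((⊤ : Opens (EuclideanSpace ℝ (Fin d))), ℂ)) {A : ℝ}
    (hA : ∀ i ≤ n + 1, ∀ x, ‖iteratedFDeriv ℝ i u x‖ ≤ A) (y : EuclideanSpace ℝ (Fin d)) :
    ‖(theta ρ χ ε ⋆[ContinuousLinearMap.mul ℝ ℂ] u) y - u y‖ ≤
      (c * (|Real.log ε| * ε) ^ (n + 1) + (ε : ℝ) ^ (n + 1)) * A *
        ∫ z, ‖z‖ ^ (n + 1) * ‖ρ z‖ := by
  have h0 : (0 : ℝ) < ε := ε.2.1
  rw [convolution_theta_apply hε, ← integral_schwartz_mul_taylorPoly hρ_int hρ_mom u n y (-ε),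
    ← integral_sub (integrable_schwartz_mul_cutoff_mul ρ χ u y _ _)
      (integrable_schwartz_mul_taylorPoly ρ u n y _), ← integral_const_mul]
  refine norm_integral_le_of_norm_le ((ρ.integrable_pow_mul volume _).const_mul _)
    (.of_forall fun z => ?_)
  have hcut := hχ ((|Real.log ε| * ε) • z)
  rw [norm_smul, Real.norm_of_nonneg (by positivity)] at hcut
  have h := norm_mul_sub_taylorPoly_le (u.contDiff.of_le (mod_cast le_top)) hA hcut y
    ((-ε : ℝ) • z)
  rw [norm_smul, norm_neg, Real.norm_of_nonneg h0.le] at h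
  rw [← mul_sub, norm_mul]
  refine (mul_le_mul_of_nonneg_left h (norm_nonneg _)).trans_eq ?_
  ring

theorem tendsto_val_atZero : Tendsto (Subtype.val : Set.Ioc (0 : ℝ) 1 → ℝ) atZero (𝓝[>] 0) :=
  tendsto_nhdsWithin_iff.2 ⟨tendsto_comap, .of_forall fun ε => ε.2.1⟩

theorem eventually_val_ne_one : ∀ᶠ ε : Set.Ioc (0 : ℝ) 1 in atZero, (ε : ℝ) ≠ 1 :=
  tendsto_comap.eventually_ne zero_ne_one

theorem eventually_norm_convolution_theta_sub_le (hρ_int : ∫ x, ρ x = 1)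
    (hρ_mom : ∀ m : Fin d → ℕ, m ≠ 0 → ∫ x, (∏ i, ((x i : ℝ) : ℂ) ^ m i) * ρ x = 0)
    (hχ_one : ∀ x, ‖x‖ ≤ 1 → χ x = 1) (p : ℕ) :
    ∃ (n : ℕ) (C : ℝ), ∀ᶠ ε in atZero,
      ∀ (u : 𝓓((⊤ : Opens (EuclideanSpace ℝ (Fin d))), ℂ)) (A : ℝ),
        (∀ i ≤ n, ∀ x, ‖iteratedFDeriv ℝ i u x‖ ≤ A) → ∀ y,
          ‖(theta ρ χ ε ⋆[ContinuousLinearMap.mul ℝ ℂ] u) y - u y‖ ≤ C * A * (ε : ℝ) ^ p := by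
  obtain ⟨c, hc, hχ⟩ := exists_norm_sub_one_le_mul_pow hχ_one
  refine ⟨2 * (p + 1), (c * 4 ^ (p + 1) + 1) * ∫ z, ‖z‖ ^ (2 * (p + 1)) * ‖ρ z‖,
    eventually_val_ne_one.mono fun ε hε u A hA y => ?_⟩
  have h0 : (0 : ℝ) < ε := ε.2.1
  have hA0 : 0 ≤ A := (norm_nonneg _).trans (hA 0 (Nat.zero_le _) 0)
  have hlog : (|Real.log ε| * ε) ^ (2 * (p + 1)) ≤ 4 ^ (p + 1) * (ε : ℝ) ^ p := by
    calc (|Real.log ε| * ε) ^ (2 * (p + 1)) = ((|Real.log ε| * ε) ^ 2) ^ (p + 1) := pow_mul _ _ _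
      _ ≤ (4 * (ε : ℝ)) ^ (p + 1) := by
          gcongr
          exact sq_abs_log_mul_self_le h0 ε.2.2
      _ ≤ 4 ^ (p + 1) * (ε : ℝ) ^ p := by
          rw [mul_pow]
          exact mul_le_mul_of_nonneg_left (pow_le_pow_of_le_one h0.le ε.2.2 p.le_succ)
            (by positivity)
  have hpow : (ε : ℝ) ^ (2 * (p + 1)) ≤ (ε : ℝ) ^ p :=
    pow_le_pow_of_le_one h0.le ε.2.2 (by lia)
  calc ‖(theta ρ χ ε ⋆[ContinuousLinearMap.mul ℝ ℂ] u) y - u y‖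
      ≤ (c * (|Real.log ε| * ε) ^ (2 * (p + 1)) + (ε : ℝ) ^ (2 * (p + 1))) * A *
          ∫ z, ‖z‖ ^ (2 * (p + 1)) * ‖ρ z‖ :=
        norm_convolution_theta_sub_le hρ_int hρ_mom (n := 2 * p + 1) (hχ _) hε u hA y
    _ ≤ (c * (4 ^ (p + 1) * (ε : ℝ) ^ p) + (ε : ℝ) ^ p) * A *
          ∫ z, ‖z‖ ^ (2 * (p + 1)) * ‖ρ z‖ := by gcongr
    _ = (c * 4 ^ (p + 1) + 1) * (∫ z, ‖z‖ ^ (2 * (p + 1)) * ‖ρ z‖) * A * (ε : ℝ) ^ p := by ring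

theorem abs_log_le_inv {t : ℝ} (h0 : 0 < t) (h1 : t ≤ 1) : |Real.log t| ≤ t⁻¹ := by
  have h := (Real.abs_log_mul_self_lt t h0 h1).le
  rwa [abs_mul, abs_of_pos h0, ← le_div_iff₀ h0, one_div] at h

theorem theta_eq_smul (hε : (ε : ℝ) ≠ 1) : theta ρ χ ε = fun x =>
    ((ε : ℝ) ^ d)⁻¹ • (χ (|Real.log ε| • x) • ρ ((ε : ℝ)⁻¹ • x)) := by
  funext x
  simp only [theta, hε, if_false, Complex.real_smul]
  ring

theorem eventually_norm_iteratedFDeriv_theta_le (ρ : 𝓢(EuclideanSpace ℝ (Fin d), ℂ))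
    (χ : 𝓓((⊤ : Opens (EuclideanSpace ℝ (Fin d))), ℝ)) (N : ℕ) :
    ∃ (q : ℕ) (C : ℝ), ∀ᶠ ε in atZero, ∀ i ≤ N, ∀ x,
      ‖iteratedFDeriv ℝ i (theta ρ χ ε) x‖ ≤ C * ((ε : ℝ) ^ q)⁻¹ := by
  obtain ⟨A, hA⟩ := exists_norm_iteratedFDeriv_schwartz_le ρ N
  obtain ⟨B, hB⟩ := exists_norm_iteratedFDeriv_testFunction_le χ N
  have hA0 : 0 ≤ A := (norm_nonneg _).trans (hA 0 (Nat.zero_le N) 0)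
  have hB0 : 0 ≤ B := (norm_nonneg _).trans (hB 0 (Nat.zero_le N) 0)
  refine ⟨d + N + N, 2 ^ N * (B * A), eventually_val_ne_one.mono fun ε hε i hi x => ?_⟩
  have h0 : (0 : ℝ) < ε := ε.2.1
  have hε1 : 1 ≤ (ε : ℝ)⁻¹ := (one_le_inv₀ h0).2 ε.2.2
  have hs : ContDiff ℝ ∞ fun x => χ (|Real.log ε| • x) := χ.contDiff.comp (contDiff_const_smul _)
  have hr : ContDiff ℝ ∞ fun x => ρ ((ε : ℝ)⁻¹ • x) := (ρ.smooth ⊤).comp (contDiff_const_smul _)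
  have hsr : ContDiff ℝ ∞ fun x => χ (|Real.log ε| • x) • ρ ((ε : ℝ)⁻¹ • x) := hs.smul hr
  have hprod := norm_iteratedFDeriv_smul_le_of_forall_le hs hr (mod_cast le_top)
    (fun j hj => norm_iteratedFDeriv_comp_smul_le (χ.contDiff.of_le (mod_cast le_top)) hB
      ((abs_abs _).trans_le (abs_log_le_inv h0 ε.2.2)) hε1 (hj.trans hi) x)
    (fun j hj => norm_iteratedFDeriv_comp_smul_le (ρ.smooth N) hA
      (abs_of_pos (inv_pos.2 h0)).le hε1 (hj.trans hi) x)
  rw [theta_eq_smul hε, iteratedFDeriv_const_smul_apply' (hsr.of_le (mod_cast le_top)).contDiffAt,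
    norm_smul, Real.norm_of_nonneg (by positivity)]
  calc ((ε : ℝ) ^ d)⁻¹ *
        ‖iteratedFDeriv ℝ i (fun x => χ (|Real.log ε| • x) • ρ ((ε : ℝ)⁻¹ • x)) x‖
      ≤ ((ε : ℝ) ^ d)⁻¹ * (2 ^ N * (((ε : ℝ)⁻¹ ^ N * B) * ((ε : ℝ)⁻¹ ^ N * A))) := by
        gcongr
        refine hprod.trans ?_
        gcongr
        exact one_le_two
    _ = 2 ^ N * (B * A) * ((ε : ℝ) ^ (d + N + N))⁻¹ := by
        rw [pow_add, pow_add, mul_inv, mul_inv, inv_pow]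
        ring

theorem eventually_norm_le_of_theta_ne_zero (ρ : 𝓢(EuclideanSpace ℝ (Fin d), ℂ))
    (χ : 𝓓((⊤ : Opens (EuclideanSpace ℝ (Fin d))), ℝ)) {r : ℝ} (hr : 0 < r) :
    ∀ᶠ ε in atZero, ∀ x, theta ρ χ ε x ≠ 0 → ‖x‖ ≤ r := by
  obtain ⟨R, hR⟩ := χ.hasCompactSupport.isCompact.isBounded.exists_norm_le
  have hlog : Tendsto (fun ε : Set.Ioc (0 : ℝ) 1 => |Real.log ε|) atZero atTop :=
    tendsto_abs_atBot_atTop.comp (Real.tendsto_log_nhdsGT_zero.comp tendsto_val_atZero)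
  filter_upwards [eventually_val_ne_one, hlog.eventually_gt_atTop 0,
    hlog.eventually_ge_atTop (R / r)] with ε hε hpos hge x hx
  rw [theta, if_neg hε] at hx
  have hsupp : ‖|Real.log ε| • x‖ ≤ R :=
    hR _ (subset_tsupport _ (Complex.ofReal_ne_zero.1 (right_ne_zero_of_mul hx)))
  rw [norm_smul, Real.norm_of_nonneg hpos.le] at hsupp
  exact le_of_mul_le_mul_left (hsupp.trans ((div_le_iff₀ hr).1 hge)) hpos

theorem isMollifierNet_theta (hρ_int : ∫ x, ρ x = 1)
    (hρ_mom : ∀ m : Fin d → ℕ, m ≠ 0 → ∫ x, (∏ i, ((x i : ℝ) : ℂ) ^ m i) * ρ x = 0)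
    (hχ_one : ∀ x, ‖x‖ ≤ 1 → χ x = 1) : IsMollifierNet (theta ρ χ) where
  contDiff := contDiff_theta ρ χ
  eventually_norm_le _ := eventually_norm_le_of_theta_ne_zero ρ χ
  eventually_norm_iteratedFDeriv_le := eventually_norm_iteratedFDeriv_theta_le ρ χ
  eventually_norm_convolution_sub_le :=
    eventually_norm_convolution_theta_sub_le hρ_int hρ_mom hχ_one

end Theta

section Regularization

variable {d : ℕ} {Ω : Opens (EuclideanSpace ℝ (Fin d))}

theorem cutConv_congr {κ κ' : 𝓓(Ω, ℝ)} {θ θ' : EuclideanSpace ℝ (Fin d) → ℂ}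
    {y : EuclideanSpace ℝ (Fin d)} (T : Distr Ω) (hθ : ContDiff ℝ ∞ θ) (hθ' : ContDiff ℝ ∞ θ')
    (h : ∀ x, κ x • θ (y - x) = κ' x • θ' (y - x)) :
    cutConv κ T θ hθ y = cutConv κ' T θ' hθ' y :=
  congrArg T (TestFunction.ext h)

/-- For `y` near `y₀`, only the values of `θ` on a ball matter, so `θ` may be cut off. -/
theorem contDiff_cutConv (κ : 𝓓(Ω, ℝ)) (T : Distr Ω) {θ : EuclideanSpace ℝ (Fin d) → ℂ}
    (hθ : ContDiff ℝ ∞ θ) : ContDiff ℝ ∞ (cutConv κ T θ hθ) := by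
  refine contDiff_iff_contDiffAt.2 fun y₀ => ?_
  obtain ⟨R, hR0, hR⟩ := κ.hasCompactSupport.isCompact.isBounded.exists_pos_norm_le
  let ζ : ContDiffBump (0 : EuclideanSpace ℝ (Fin d)) :=
    ⟨‖y₀‖ + 1 + R, ‖y₀‖ + 1 + R + 1, by positivity, lt_add_one _⟩
  let θ' : 𝓓((⊤ : Opens (EuclideanSpace ℝ (Fin d))), ℂ) :=
    ⟨fun x => ζ x • θ x, ζ.contDiff.smul hθ, ζ.hasCompactSupport.smul_right, Set.subset_univ _⟩
  refine (contDiff_cutConv_testFunction κ T θ').contDiffAt.congr_of_eventuallyEq ?_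
  filter_upwards [Metric.ball_mem_nhds y₀ one_pos] with y hy
  refine cutConv_congr T hθ θ'.contDiff fun x => ?_
  by_cases hx : x ∈ tsupport κ
  · have hyx : ‖y - x‖ ≤ ‖y₀‖ + 1 + R :=
      (norm_sub_le y x).trans (add_le_add (by
        linarith [norm_le_norm_add_norm_sub y₀ y, mem_ball_iff_norm'.1 hy]) (hR x hx))
    change κ x • θ (y - x) = κ x • ζ (y - x) • θ (y - x)
    rw [ζ.one_of_mem_closedBall (mem_closedBall_zero_iff.2 hyx), one_smul]
  · rw [image_eq_zero_of_notMem_tsupport hx, zero_smul, zero_smul]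

/-- The restriction to `Ω` of a smooth function on the whole space. -/
noncomputable def SmoothFn.ofContDiff (f : EuclideanSpace ℝ (Fin d) → ℂ) (hf : ContDiff ℝ ∞ f) :
    SmoothFn Ω :=
  ⟨fun y => f y, hf.contDiffOn.congr fun x hx => zeroExt_apply _ (⟨x, hx⟩ : Ω)⟩

/-- The net `((κ_ε T) ∗ θ_ε)_ε`. -/
noncomputable def regularization (κ : Set.Ioc (0 : ℝ) 1 → 𝓓(Ω, ℝ))
    {θ : Set.Ioc (0 : ℝ) 1 → EuclideanSpace ℝ (Fin d) → ℂ} (hθ : ∀ ε, ContDiff ℝ ∞ (θ ε))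
    (T : Distr Ω) : Net Ω :=
  fun ε => SmoothFn.ofContDiff _ (contDiff_cutConv (κ ε) T (hθ ε))

/-- Nets of cutoff functions which are eventually equal to `1` on every compact subset of `Ω`. -/
def IsCutoffNet (κ : Set.Ioc (0 : ℝ) 1 → 𝓓(Ω, ℝ)) : Prop :=
  ∀ K : Set (EuclideanSpace ℝ (Fin d)), IsCompact K → K ⊆ Ω → ∀ᶠ ε in atZero, ∀ x ∈ K, κ ε x = 1

instance : NeBot atZero := by
  refine comap_neBot fun t ht => ?_
  obtain ⟨r, hr, h⟩ := Metric.mem_nhds_iff.1 ht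
  refine ⟨⟨min (r / 2) 1, by positivity, min_le_right _ _⟩, h ?_⟩
  rw [mem_ball_zero_iff, Real.norm_of_nonneg (by positivity)]
  exact (min_le_left _ _).trans_lt (half_lt_self hr)

variable {κ : Set.Ioc (0 : ℝ) 1 → 𝓓(Ω, ℝ)} {θ : Set.Ioc (0 : ℝ) 1 → EuclideanSpace ℝ (Fin d) → ℂ}
  {K : Set (EuclideanSpace ℝ (Fin d))}

/-- Since the supports of the mollifiers shrink, one cutoff `η` serves all small `ε` near `K`. -/
theorem exists_cutConv_eq (hκ : IsCutoffNet κ) (hθ : IsMollifierNet θ) (hK : IsCompact K)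
    (hKΩ : K ⊆ Ω) : ∃ (η : 𝓓(Ω, ℝ)) (U : Set (EuclideanSpace ℝ (Fin d))), IsOpen U ∧ K ⊆ U ∧
      (∀ x ∈ U, η x = 1) ∧ ∀ᶠ ε in atZero, ∀ T, ∀ y ∈ U,
        cutConv (κ ε) T (θ ε) (hθ.contDiff ε) y = cutConv η T (θ ε) (hθ.contDiff ε) y := by
  obtain ⟨r, hr, hrΩ⟩ := hK.exists_cthickening_subset_open Ω.isOpen hKΩ
  have hκ1 := hκ _ hK.cthickening hrΩ
  obtain ⟨ε₀, hε₀⟩ := hκ1.exists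
  refine ⟨κ ε₀, Metric.thickening (r / 2) K, Metric.isOpen_thickening,
    Metric.self_subset_thickening (half_pos hr) K, fun x hx => hε₀ x
      (Metric.thickening_subset_cthickening_of_le (half_le_self hr.le) K hx), ?_⟩
  filter_upwards [hκ1, hθ.eventually_norm_le _ (half_pos hr)] with ε hε hsupp T y hy
  refine cutConv_congr T _ _ fun x => ?_
  by_cases hx : θ ε (y - x) = 0
  · rw [hx, smul_zero, smul_zero]
  · obtain ⟨z, hz, hyz⟩ := Metric.mem_thickening_iff.1 hy
    have hxy : dist x y ≤ r / 2 := by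
      rw [dist_comm, dist_eq_norm]
      exact hsupp _ hx
    have hxK : x ∈ Metric.cthickening r K :=
      Metric.mem_cthickening_of_dist_le x z r K hz (by linarith [dist_triangle x y z])
    rw [hε x hxK, hε₀ x hxK]

theorem zeroExt_eventuallyEq {f : Ω → ℂ} {g : EuclideanSpace ℝ (Fin d) → ℂ}
    {U : Set (EuclideanSpace ℝ (Fin d))} (hU : IsOpen U)
    (h : ∀ y : Ω, (y : EuclideanSpace ℝ (Fin d)) ∈ U → f y = g y)
    {x : EuclideanSpace ℝ (Fin d)} (hxU : x ∈ U) (hx : x ∈ Ω) : zeroExt Ω f =ᶠ[𝓝 x] g := by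
  filter_upwards [hU.mem_nhds hxU, Ω.isOpen.mem_nhds hx] with y hy hyΩ
  exact (zeroExt_apply f ⟨y, hyΩ⟩).trans (h ⟨y, hyΩ⟩ hy)

theorem norm_smoothSeminorm_le_of_eqOn (hKΩ : K ⊆ Ω) {f : SmoothFn Ω}
    {g : EuclideanSpace ℝ (Fin d) → ℂ} {U : Set (EuclideanSpace ℝ (Fin d))} (hU : IsOpen U)
    (hKU : K ⊆ U) (h : ∀ y : Ω, (y : EuclideanSpace ℝ (Fin d)) ∈ U → (f : Ω → ℂ) y = g y)
    {l : ℕ} {C : ℝ} (hg : ∀ i ≤ l, ∀ y, ‖iteratedFDeriv ℝ i g y‖ ≤ C) :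
    ‖smoothSeminorm K l f‖ ≤ C := by
  rw [Real.norm_of_nonneg (smoothSeminorm_nonneg f)]
  refine smoothSeminorm_le ((norm_nonneg _).trans (hg 0 (Nat.zero_le l) 0)) fun i hi y hy => ?_
  rw [((zeroExt_eventuallyEq hU h (hKU hy) (hKΩ hy)).iteratedFDeriv ℝ i).eq_of_nhds]
  exact hg i hi y

theorem isLittleO_inv_pow_succ (q : ℕ) :
    (fun ε : Set.Ioc (0 : ℝ) 1 => ((ε : ℝ) ^ q)⁻¹) =o[atZero] fun ε => ((ε : ℝ) ^ (q + 1))⁻¹ := by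
  have h := (isBigO_refl (fun ε : Set.Ioc (0 : ℝ) 1 => ((ε : ℝ) ^ q)⁻¹) atZero).mul_isLittleO
    (isLittleO_const_inv 1)
  simpa only [mul_one, ← mul_inv, ← pow_add] using h

theorem isModerate_regularization (hκ : IsCutoffNet κ) (hθ : IsMollifierNet θ) (T : Distr Ω) :
    IsModerate (regularization κ hθ.contDiff T) := by
  intro l K hK hKΩ
  obtain ⟨η, U, hU, hKU, -, hη⟩ := exists_cutConv_eq hκ hθ hK hKΩ
  obtain ⟨N, C, hC⟩ := exists_norm_iteratedFDeriv_cutConv_le η T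
  obtain ⟨q, B, hB⟩ := hθ.eventually_norm_iteratedFDeriv_le (N + l)
  refine ⟨q + 1, IsBigO.trans_isLittleO (IsBigO.of_bound (C * B) ?_) (isLittleO_inv_pow_succ q)⟩
  filter_upwards [hη, hB, hθ.eventually_hasCompactSupport] with ε hηε hBε hcε
  rw [norm_inv, norm_pow, Real.norm_of_nonneg ε.2.1.le, mul_assoc]
  exact norm_smoothSeminorm_le_of_eqOn hKΩ hU hKU (fun y hy => hηε T y hy) fun i hi =>
    hC ⟨θ ε, hθ.contDiff ε, hcε, Set.subset_univ _⟩ i _ fun j hj =>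
      hBε j (hj.trans (Nat.add_le_add_left hi N))

/-- The smooth function `η f` on the whole space, for a cutoff `η ∈ D(Ω)`. -/
noncomputable def cutSmooth (η : 𝓓(Ω, ℝ)) (f : SmoothFn Ω) :
    𝓓((⊤ : Opens (EuclideanSpace ℝ (Fin d))), ℂ) where
  toFun x := η x • zeroExt Ω f x
  contDiff' := contDiff_iff_contDiffAt.2 fun x => by
    by_cases hx : x ∈ tsupport η
    · have hxΩ := η.tsupport_subset hx
      exact η.contDiff.contDiffAt.smul ((f.2 x hxΩ).contDiffAt (Ω.isOpen.mem_nhds hxΩ))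
    · refine (contDiffAt_const (c := (0 : ℂ))).congr_of_eventuallyEq ?_
      filter_upwards [(isClosed_tsupport η).isOpen_compl.mem_nhds hx] with z hz
      rw [image_eq_zero_of_notMem_tsupport hz, zero_smul]
  hasCompactSupport' := η.hasCompactSupport.smul_right
  tsupport_subset' := Set.subset_univ _

theorem cutConv_ofSmooth (η : 𝓓(Ω, ℝ)) (f : SmoothFn Ω) {θ : EuclideanSpace ℝ (Fin d) → ℂ}
    (hθ : ContDiff ℝ ∞ θ) (y : EuclideanSpace ℝ (Fin d)) :
    cutConv η (ofSmooth f) θ hθ y = (θ ⋆[ContinuousLinearMap.mul ℝ ℂ] cutSmooth η f) y := by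
  rw [cutConv, ofSmooth_apply, convolution_eq_swap]
  refine integral_congr_ae (.of_forall fun x => ?_)
  change η x • θ (y - x) * zeroExt Ω f x = θ (y - x) * η x • zeroExt Ω f x
  rw [smul_mul_assoc, mul_smul_comm]

theorem isLittleO_pow_succ (p : ℕ) :
    (fun ε : Set.Ioc (0 : ℝ) 1 => (ε : ℝ) ^ (p + 1)) =o[atZero] fun ε => (ε : ℝ) ^ p :=
  (isLittleO_pow_pow (𝕜 := ℝ) (Nat.lt_succ_self p)).comp_tendsto tendsto_comap

theorem isNegligible_regularization_ofSmooth_sub (hκ : IsCutoffNet κ) (hθ : IsMollifierNet θ)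
    (f : SmoothFn Ω) :
    IsNegligible fun ε => regularization κ hθ.contDiff (ofSmooth f) ε - f := by
  intro l K hK hKΩ p
  obtain ⟨η, U, hU, hKU, hηU, hη⟩ := exists_cutConv_eq hκ hθ hK hKΩ
  obtain ⟨C, hC⟩ :=
    hθ.eventually_norm_iteratedFDeriv_convolution_sub_le (cutSmooth η f) l (p + 1)
  refine IsBigO.trans_isLittleO (IsBigO.of_bound C ?_) (isLittleO_pow_succ p)
  filter_upwards [hη, hC] with ε hηε hCε
  rw [norm_pow, Real.norm_of_nonneg ε.2.1.le]
  refine norm_smoothSeminorm_le_of_eqOn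
    (g := (θ ε ⋆[ContinuousLinearMap.mul ℝ ℂ] cutSmooth η f) - cutSmooth η f)
    hKΩ hU hKU (fun y hy => ?_) fun i hi y => ?_
  · have hf : cutSmooth η f y = (f : Ω → ℂ) y := by
      change η y • zeroExt Ω f y = _
      rw [hηU y hy, one_smul, zeroExt_apply]
    rw [Pi.sub_apply, ← cutConv_ofSmooth η f (hθ.contDiff ε), hf, ← hηε _ y hy]
    rfl
  · have hconv : ContDiff ℝ ∞ (θ ε ⋆[ContinuousLinearMap.mul ℝ ℂ] cutSmooth η f) :=
      (cutSmooth η f).hasCompactSupport.contDiff_convolution_right (n := ⊤) _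
        (hθ.contDiff ε).continuous.locallyIntegrable (cutSmooth η f).contDiff
    rw [iteratedFDeriv_sub_apply (hconv.of_le (mod_cast le_top)).contDiffAt
      ((cutSmooth η f).contDiff.of_le (mod_cast le_top)).contDiffAt]
    exact hCε i hi y

end Regularization

section Embedding

variable {d : ℕ} {Ω : Opens (EuclideanSpace ℝ (Fin d))} {κ : Set.Ioc (0 : ℝ) 1 → 𝓓(Ω, ℝ)}
  {θ : Set.Ioc (0 : ℝ) 1 → EuclideanSpace ℝ (Fin d) → ℂ}

theorem testConv_reflectAt_zero (φ ψ : 𝓓((⊤ : Opens (EuclideanSpace ℝ (Fin d))), ℂ)) :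
    testConv φ (reflectAt ψ 0) = reflectAt (testConv ψ (reflectAt φ 0)) 0 := by
  refine TestFunction.ext fun x => ?_
  change ∫ t, φ t * ψ (0 - (x - t)) = ∫ t, ψ t * φ (0 - (0 - x - t))
  rw [← integral_add_right_eq_self _ x]
  refine integral_congr_ae (.of_forall fun t => ?_)
  change φ (t + x) * ψ (0 - (x - (t + x))) = ψ t * φ (0 - (0 - x - t))
  rw [show 0 - (x - (t + x)) = t by abel, show 0 - (0 - x - t) = t + x by abel, mul_comm]

theorem reflectAt_zero_reflectAt_zero (φ : 𝓓((⊤ : Opens (EuclideanSpace ℝ (Fin d))), ℂ)) :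
    reflectAt (reflectAt φ 0) 0 = φ :=
  TestFunction.ext fun x => congrArg φ (by simp only [zero_sub, neg_neg])

theorem norm_iteratedFDeriv_testConv_reflectAt_sub (i : ℕ)
    (φ ψ : 𝓓((⊤ : Opens (EuclideanSpace ℝ (Fin d))), ℂ)) (x : EuclideanSpace ℝ (Fin d)) :
    ‖iteratedFDeriv ℝ i (testConv φ (reflectAt ψ 0) - φ) x‖ =
      ‖iteratedFDeriv ℝ i (ψ ⋆[ContinuousLinearMap.mul ℝ ℂ] reflectAt φ 0) (-x) -
        iteratedFDeriv ℝ i (reflectAt φ 0) (-x)‖ := by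
  have h : testConv φ (reflectAt ψ 0) - φ =
      reflectAt (testConv ψ (reflectAt φ 0) - reflectAt φ 0) 0 := by
    rw [testConv_reflectAt_zero]
    conv_lhs => arg 2; rw [← reflectAt_zero_reflectAt_zero φ]
    rfl
  rw [h, norm_iteratedFDeriv_reflectAt_zero]
  exact congrArg norm (iteratedFDeriv_sub_apply
    ((testConv ψ (reflectAt φ 0)).contDiff.of_le (mod_cast le_top)).contDiffAt
    ((reflectAt φ 0).contDiff.of_le (mod_cast le_top)).contDiffAt)

theorem IsMollifierNet.tendsto_integral_mul_cutConv (hθ : IsMollifierNet θ) (η : 𝓓(Ω, ℝ))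
    (T : Distr Ω) (φ : 𝓓((⊤ : Opens (EuclideanSpace ℝ (Fin d))), ℂ)) :
    Tendsto (fun ε => ∫ y, φ y * cutConv η T (θ ε) (hθ.contDiff ε) y) atZero
      (𝓝 (cutForm η T φ)) := by
  obtain ⟨N, C, hC⟩ := exists_norm_cutForm_le η T
  obtain ⟨B, hB⟩ := hθ.eventually_norm_iteratedFDeriv_convolution_sub_le (reflectAt φ 0) N 1
  have hlim : Tendsto (fun ε : Set.Ioc (0 : ℝ) 1 => C * (B * (ε : ℝ) ^ 1)) atZero (𝓝 0) := by
    have hε : Tendsto (fun ε : Set.Ioc (0 : ℝ) 1 => (ε : ℝ)) atZero (𝓝 0) := tendsto_comap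
    simpa only [pow_one, mul_zero] using (hε.const_mul B).const_mul C
  refine tendsto_iff_norm_sub_tendsto_zero.2
    (squeeze_zero' (.of_forall fun _ => norm_nonneg _) ?_ hlim)
  filter_upwards [hB, hθ.eventually_hasCompactSupport] with ε hBε hcε
  let ψ : 𝓓((⊤ : Opens (EuclideanSpace ℝ (Fin d))), ℂ) :=
    ⟨θ ε, hθ.contDiff ε, hcε, Set.subset_univ _⟩
  have hψ (i : ℕ) (hi : i ≤ N) (x : EuclideanSpace ℝ (Fin d)) :
      ‖iteratedFDeriv ℝ i (testConv φ (reflectAt ψ 0) - φ) x‖ ≤ B * (ε : ℝ) ^ 1 :=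
    (norm_iteratedFDeriv_testConv_reflectAt_sub i φ ψ x).trans_le (hBε i hi (-x))
  rw [show ∫ y, φ y * cutConv η T (θ ε) (hθ.contDiff ε) y = _ from integral_mul_cutConv η T φ ψ,
    ← map_sub]
  exact hC _ _ hψ

theorem tendsto_integral_mul_of_isNegligible {g : Net Ω} (hg : IsNegligible g) (φ : 𝓓(Ω, ℂ)) :
    Tendsto (fun ε => ∫ y, φ y * zeroExt Ω (g ε) y) atZero (𝓝 0) := by
  have hlim := ((isLittleO_one_iff ℝ).1 (by
    simpa only [pow_zero] using hg 0 _ φ.hasCompactSupport φ.tsupport_subset 0)).const_mul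
      (∫ y, ‖φ y‖)
  rw [mul_zero] at hlim
  refine squeeze_zero_norm (fun ε => ?_) hlim
  rw [← integral_mul_const]
  refine norm_integral_le_of_norm_le ((φ.continuous.norm.integrable_of_hasCompactSupport
    φ.hasCompactSupport.norm).mul_const _) (.of_forall fun y => ?_)
  rw [norm_mul]
  by_cases hy : y ∈ tsupport φ
  · gcongr
    simpa only [norm_iteratedFDeriv_zero] using
      le_smoothSeminorm φ.hasCompactSupport φ.tsupport_subset (g ε) (le_refl 0) hy
  · simp only [image_eq_zero_of_notMem_tsupport hy, norm_zero, zero_mul, le_refl]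

theorem eq_zero_of_isNegligible_regularization (hκ : IsCutoffNet κ) (hθ : IsMollifierNet θ)
    {T : Distr Ω} (hT : IsNegligible (regularization κ hθ.contDiff T)) : T = 0 := by
  refine ContinuousLinearMap.ext fun φ => ?_
  obtain ⟨η, U, -, hKU, hηU, hη⟩ :=
    exists_cutConv_eq hκ hθ φ.hasCompactSupport.isCompact φ.tsupport_subset
  let φ' : 𝓓((⊤ : Opens (EuclideanSpace ℝ (Fin d))), ℂ) :=
    ⟨φ, φ.contDiff, φ.hasCompactSupport, Set.subset_univ _⟩
  have hcut : cutForm η T φ' = T φ := by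
    refine congrArg T (TestFunction.ext fun x => ?_)
    change η x • φ x = φ x
    by_cases hx : x ∈ tsupport φ
    · rw [hηU x (hKU hx), one_smul]
    · rw [image_eq_zero_of_notMem_tsupport hx, smul_zero]
  have heq : (fun ε => ∫ y, φ y * zeroExt Ω (regularization κ hθ.contDiff T ε) y) =ᶠ[atZero]
      fun ε => ∫ y, φ' y * cutConv η T (θ ε) (hθ.contDiff ε) y := by
    filter_upwards [hη] with ε hηε
    refine integral_congr_ae (.of_forall fun y => ?_)
    by_cases hy : y ∈ tsupport φ
    · exact congrArg (φ y * ·) ((zeroExt_apply _ (⟨y, φ.tsupport_subset hy⟩ : Ω)).trans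
        (hηε T y (hKU hy)))
    · change φ y * _ = φ y * _
      rw [image_eq_zero_of_notMem_tsupport hy, zero_mul, zero_mul]
  rw [← hcut]
  exact tendsto_nhds_unique (hθ.tendsto_integral_mul_cutConv η T φ')
    ((tendsto_integral_mul_of_isNegligible hT φ).congr' heq)

/-- The linear map `T ↦ ((κ_ε T) ∗ θ_ε)_ε` with values in the moderate nets. -/
noncomputable def regularizationₗ (hκ : IsCutoffNet κ) (hθ : IsMollifierNet θ) :
    Distr Ω →ₗ[ℂ] Moderate Ω where
  toFun T := ⟨regularization κ hθ.contDiff T, isModerate_regularization hκ hθ T⟩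
  map_add' _ _ := rfl
  map_smul' _ _ := rfl

/-- The embedding `T ↦ [((κ_ε T) ∗ θ_ε)_ε]` of the distributions into the Colombeau algebra. -/
noncomputable def embedding (hκ : IsCutoffNet κ) (hθ : IsMollifierNet θ) : Distr Ω →ₗ[ℂ] G Ω :=
  (Ideal.Quotient.mkₐ ℂ (Negligible Ω)).toLinearMap ∘ₗ regularizationₗ hκ hθ

theorem embedding_injective (hκ : IsCutoffNet κ) (hθ : IsMollifierNet θ) :
    Function.Injective (embedding hκ hθ) :=
  (injective_iff_map_eq_zero _).2 fun _ hT =>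
    eq_zero_of_isNegligible_regularization hκ hθ (Ideal.Quotient.eq_zero_iff_mem.1 hT)

theorem embedding_ofSmooth (hκ : IsCutoffNet κ) (hθ : IsMollifierNet θ) (f : SmoothFn Ω) :
    embedding hκ hθ (ofSmooth f) = sigma f :=
  Ideal.Quotient.eq.2 (isNegligible_regularization_ofSmooth_sub hκ hθ f)

end Embedding

section Cutoff

variable {d : ℕ} {Ω : Opens (EuclideanSpace ℝ (Fin d))}

theorem eventually_subset_exhaustion {K : Set (EuclideanSpace ℝ (Fin d))} (hK : IsCompact K)
    (hKΩ : K ⊆ Ω) : ∀ᶠ ε : Set.Ioc (0 : ℝ) 1 in atZero, K ⊆ exhaustion Ω (ε : ℝ) := by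
  obtain ⟨r, hr, hrΩ⟩ := hK.exists_thickening_subset_open Ω.isOpen hKΩ
  obtain ⟨R, hR⟩ := hK.isBounded.exists_norm_le
  filter_upwards [tendsto_comap.eventually_lt_const hr,
    (tendsto_inv_nhdsGT_zero.comp tendsto_val_atZero).eventually_ge_atTop R] with ε hεr hεR x hx
  refine ⟨hKΩ hx, Metric.le_infEDist.2 fun z hz => ?_,
    (hR x hx).trans (hεR.trans_eq (one_div _).symm)⟩
  by_contra h
  rw [not_le, edist_dist, ENNReal.ofReal_lt_ofReal_iff ε.2.1, dist_comm] at h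
  exact hz (hrΩ (Metric.mem_thickening_iff.2 ⟨x, hx, h.trans hεr⟩))

theorem isCutoffNet_of_eq_one_on_exhaustion {κ : Set.Ioc (0 : ℝ) 1 → 𝓓(Ω, ℝ)}
    (hκ : ∀ ε : Set.Ioc (0 : ℝ) 1, ∀ x ∈ exhaustion Ω (ε : ℝ), κ ε x = 1) : IsCutoffNet κ :=
  fun _ hK hKΩ => (eventually_subset_exhaustion hK hKΩ).mono fun ε h x hx => hκ ε x (h hx)

end Cutoff

end Colombeau

theorem mainTheorem4_general {d : ℕ} {Ω : TopologicalSpace.Opens (EuclideanSpace ℝ (Fin d))}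
    {κ : Set.Ioc (0 : ℝ) 1 → 𝓓(Ω, ℝ)} {θ : Set.Ioc (0 : ℝ) 1 → EuclideanSpace ℝ (Fin d) → ℂ}
    (hκ : Colombeau.IsCutoffNet κ) (hθ : Colombeau.IsMollifierNet θ) :
    ∃ ι : Colombeau.Distr Ω →ₗ[ℂ] Colombeau.G Ω,
      (∀ T : Colombeau.Distr Ω, ∃ f : Colombeau.Moderate Ω,
        (∀ (ε : Set.Ioc (0 : ℝ) 1) (y : Ω),
          ((f : Colombeau.Net Ω) ε : Ω → ℂ) y =
            Colombeau.cutConv (κ ε) T (θ ε) (hθ.contDiff ε) y) ∧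
        ι T = Colombeau.cls f) ∧
      Function.Injective ι ∧
      ∀ f : Colombeau.SmoothFn Ω, ι (Colombeau.ofSmooth f) = Colombeau.sigma f :=
  ⟨Colombeau.embedding hκ hθ,
    fun T => ⟨Colombeau.regularizationₗ hκ hθ T, fun _ _ => rfl, rfl⟩,
    Colombeau.embedding_injective hκ hθ, Colombeau.embedding_ofSmooth hκ hθ⟩

theorem mainTheorem4 (d : ℕ) (Ω : TopologicalSpace.Opens (EuclideanSpace ℝ (Fin d)))
    -- the mollifier `ρ`: an even Schwartz function, of integral 1, all higher moments zero
    (ρ : 𝓢(EuclideanSpace ℝ (Fin d), ℂ))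
    (hρ_even : ∀ x, ρ (-x) = ρ x)
    (hρ_int : ∫ x, ρ x = 1)
    (hρ_mom : ∀ m : Fin d → ℕ, m ≠ 0 → ∫ x, (∏ i, ((x i : ℝ) : ℂ) ^ m i) * ρ x = 0)
    -- the cutoff `χ` of the mollifiers
    (χ : 𝓓((⊤ : TopologicalSpace.Opens (EuclideanSpace ℝ (Fin d))), ℝ))
    (hχ_range : ∀ x, 0 ≤ χ x ∧ χ x ≤ 1)
    (hχ_one : ∀ x, ‖x‖ ≤ 1 → χ x = 1)
    (hχ_zero : ∀ x, 2 ≤ ‖x‖ → χ x = 0)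
    -- the cutoffs `κ_ε` of the distributions
    (κ : Set.Ioc (0 : ℝ) 1 → 𝓓(Ω, ℝ))
    (hκ_range : ∀ (ε : Set.Ioc (0 : ℝ) 1) x, 0 ≤ κ ε x ∧ κ ε x ≤ 1)
    (hκ_one : ∀ ε : Set.Ioc (0 : ℝ) 1, ∀ x ∈ Colombeau.exhaustion Ω (ε : ℝ), κ ε x = 1) :
    ∃ ι : Colombeau.Distr Ω →ₗ[ℂ] Colombeau.G Ω,
      -- `ι T` is the class of the net `((κ_ε T) ∗ θ_ε)_ε`, which is smooth and moderate on `Ω`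
      (∀ T : Colombeau.Distr Ω, ∃ f : Colombeau.Moderate Ω,
        (∀ (ε : Set.Ioc (0 : ℝ) 1) (y : Ω),
          ((f : Colombeau.Net Ω) ε : Ω → ℂ) y =
            Colombeau.cutConv (κ ε) T (Colombeau.theta ρ χ ε) (Colombeau.contDiff_theta ρ χ ε) y) ∧
        ι T = Colombeau.cls f) ∧
      Function.Injective ι ∧
      ∀ f : Colombeau.SmoothFn Ω, ι (Colombeau.ofSmooth f) = Colombeau.sigma f :=
  mainTheorem4_general (Colombeau.isCutoffNet_of_eq_one_on_exhaustion hκ_one)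
    (Colombeau.isMollifierNet_theta hρ_int hρ_mom hχ_one)
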